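/- Consider the MIMO block-fading channel $Y_i=\sqrt{\mathsf{snr}/n_t}\,H_iX_i+Z_i$, $i=1,\dots,N$, with $N\ge1$ fading blocks, $n_t\ge1$ transmit and $n_r\ge1$ receive antennas, where all entries of the matrices $H_i\in\mathbb C^{n_r\times n_t}$ and of the noise $Z_i$ are i.i.d. circularly symmetric complex Gaussian $\mathcal N_{\mathbb C}(0,1)$. For an input distribution on $\mathbb C^{n_t}$ let $$I_H(\mathsf{snr})=\frac1N\sum_{i=1}^N\mathbb E\Big[\log_2\frac{P(Y_i\mid X_i,H_i)}{P(Y_i\mid H_i)}\,\Big|\,H_i\Big]$$ be the instantaneous mutual information per channel use. For a real Gaussian source of unit variance and bandwidth ratio $b>0$, a transmitter that knows $H=(H_1,\dots,H_N)$ attains the instantaneous distortion $D(H,\mathsf{snr})=2^{-2bI_H(\mathsf{snr})}$; the transmitter-informed lower bound on the distortion outage probability at target distortion $\bar D$ is $P_{\rm out}(\mathsf{snr},\bar D)=\Pr\{D(H,\mathsf{snr})>\bar D\}$, and its SNR exponent is $$d^{\rm tx}_{\rm out}(b,\bar D)=\lim_{\mathsf{snr}\to\infty}\frac{-\log P_{\rm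 out}(\mathsf{snr},\bar D)}{\log\mathsf{snr}}.$$ Fix $b>0$ and $0<\bar D<1$, and put $R_s(\bar D)=-\tfrac12\log_2\bar D$. Then the following hold (in particular, the limits exist). (i) For Gaussian channel inputs (the entries of $X_i$ i.i.d. $\mathcal N_{\mathbb C}(0,1)$), $d^{\rm tx}_{\rm out}(b,\bar D)=N\,n_t\,n_r$. (ii) For discrete channel inputs (the entries of $X_i$ i.i.d. uniform on a finite constellation $\mathcal X\subset\mathbb C$ with $|\mathcal X|=2^m\ge2$), whenever $R_s(\bar D)/b<n_t\,m$, $$d^{\rm tx}_{\rm out}(b,\bar D)=n_r\Big(1+\Big\lfloor N\Big(n_t-\frac{R_s(\bar D)}{b\,m}\Big)\Big\rfloor\Big).$$ -/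

import Mathlib

open MeasureTheory ProbabilityTheory Filter Topology

noncomputable section

namespace MIMO

/-- Density `π⁻¹ exp (-|z|²)` of the circularly symmetric complex Gaussian law with
mean zero and unit variance, with respect to Lebesgue measure on `ℂ`. -/
def stdComplexGaussianPDF (z : ℂ) : ℝ :=
  Real.pi⁻¹ * Real.exp (-‖z‖ ^ 2)

/-- The law `N_ℂ(0, 1)`. -/
def stdComplexGaussian : Measure ℂ :=
  volume.withDensity fun z => ENNReal.ofReal (stdComplexGaussianPDF z)

/-- Law of the channel `H = (H₁, …, H_N)`: `N` fading blocks, each an `nr × nt` matrix, with all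
entries i.i.d. `N_ℂ(0, 1)`. -/
def channelLaw (N nr nt : ℕ) : Measure (Fin N → Fin nr → Fin nt → ℂ) :=
  Measure.pi fun _ : Fin N => Measure.pi fun _ : Fin nr => Measure.pi fun _ : Fin nt =>
    stdComplexGaussian

/-- Gaussian channel inputs: the `nt` transmitted symbols are i.i.d. `N_ℂ(0, 1)`. -/
def gaussianInput (nt : ℕ) : Measure (Fin nt → ℂ) :=
  Measure.pi fun _ => stdComplexGaussian

/-- Discrete channel inputs: the `nt` transmitted symbols are i.i.d. uniform on the constellation
`𝒳`, that is, the transmitted vector is uniform on `𝒳 ^ nt`. -/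
def discreteInput (nt : ℕ) (𝒳 : Finset ℂ) : Measure (Fin nt → ℂ) :=
  uniformOn {x | ∀ j, x j ∈ 𝒳}

/-- Conditional density of the output `y` of one use of the channel
`Y = √(snr / nt) H X + Z`, given the input `x` and the channel matrix `H`; the entries of the
noise `Z` are i.i.d. `N_ℂ(0, 1)`. -/
def condDensity {nr nt : ℕ} (snr : ℝ) (H : Fin nr → Fin nt → ℂ)
    (x : Fin nt → ℂ) (y : Fin nr → ℂ) : ℝ :=
  ∏ r, stdComplexGaussianPDF (y r - (Real.sqrt (snr / nt) : ℂ) * (Matrix.of H).mulVec x r)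

/-- Density of the output given the channel matrix only, for an input of law `Q`. -/
def outDensity {nr nt : ℕ} (Q : Measure (Fin nt → ℂ)) (snr : ℝ)
    (H : Fin nr → Fin nt → ℂ) (y : Fin nr → ℂ) : ℝ :=
  ∫ x, condDensity snr H x y ∂Q

/-- Mutual information (bits per channel use) between input and output in one block with channel
matrix `H`: `E[log₂ (P(Y | X, H) / P(Y | H)) | H]`. -/
def blockMutualInfo {nr nt : ℕ} (Q : Measure (Fin nt → ℂ)) (snr : ℝ)
    (H : Fin nr → Fin nt → ℂ) : ℝ :=
  ∫ x, (∫ y, condDensity snr H x y *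
    Real.logb 2 (condDensity snr H x y / outDensity Q snr H y) ∂volume) ∂Q

/-- Instantaneous mutual information `I_H(snr)` of the block-fading channel. -/
def mutualInfo {N nr nt : ℕ} (Q : Measure (Fin nt → ℂ)) (snr : ℝ)
    (H : Fin N → Fin nr → Fin nt → ℂ) : ℝ :=
  (1 / (N : ℝ)) * ∑ i, blockMutualInfo Q snr (H i)

/-- Distortion-rate function `2 ^ (-2 R)` of the real Gaussian source of unit variance. -/
def distortionRate (R : ℝ) : ℝ := (2 : ℝ) ^ (-2 * R)

/-- Rate-distortion function `-(log₂ D) / 2` of the real Gaussian source of unit variance. -/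
def rateDistortion (D : ℝ) : ℝ := -Real.logb 2 D / 2

/-- Instantaneous distortion with an informed transmitter, which uses the channel code rate
`I_H(snr)` and hence the source rate `b * I_H(snr)`. -/
def txDistortion {N nr nt : ℕ} (Q : Measure (Fin nt → ℂ)) (b snr : ℝ)
    (H : Fin N → Fin nr → Fin nt → ℂ) : ℝ :=
  distortionRate (b * mutualInfo Q snr H)

/-- Transmitter-informed lower bound on the distortion outage probability:
`Pr {D(H, snr) > D̄}` for the informed transmitter. -/
def txOutageProb (N nr : ℕ) {nt : ℕ} (Q : Measure (Fin nt → ℂ)) (b Dbar snr : ℝ) : ℝ :=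
  (channelLaw N nr nt).real {H | txDistortion Q b snr H > Dbar}

/-- `d` is the SNR exponent of the outage probability `P`:
`-log P(snr) / log snr → d` as `snr → ∞`. -/
def HasSNRExponent (P : ℝ → ℝ) (d : ℝ) : Prop :=
  Tendsto (fun snr => -Real.log (P snr) / Real.log snr) atTop (𝓝 d)

end MIMO

end

/-!
Both exponents follow from two bounds on the mutual information of one block with channel matrix
`H`, together with small-ball estimates for `H`.

*Lower bound* (`neg_log_avgBhattacharyya_le`). The mutual information is at least the cutoff rate
`-log E exp (-snr / nt * |H (x - x')|² / 4)`, where `x` and `x'` are independent inputs. This bound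
is in closed form, and it turns out to be sharp enough for both kinds of input.

*Upper bound* (`divergence_bounds`). By Jensen's inequality, the divergence of the Gaussian with
mean `a₀` from a mixture of Gaussians is at most the mean squared distance from `a₀` to the means
of the mixture. The mixture may be replaced by a part of it, at the cost of minus the logarithm of
its weight.

For Gaussian inputs, the cutoff rate is at least `log (snr * |H r j|² / (4 * nt))` for every entry,
so that outage forces all `N * nt * nr` squared entries to be of order `1 / snr`; conversely
entries that are a small multiple of this size cause outage. The probability that
`|H r j|² ≤ t` is of order `t`.

For discrete inputs from `𝒳`, let `V` be the span of the differences `d` of codebook vectors with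
`|H d|² ≤ snr ^ (-1 + ε)`. An affine subspace of dimension `k` contains at most `|𝒳| ^ k` codebook
vectors (`card_codebook_filter_sub_mem_le`), so the cutoff rate of the block is at least
`(nt - dim V) * log |𝒳|` up to an error that is exponentially small in a power of `snr`
(`log_avgBhattacharyya_discreteInput_le`). Outage therefore requires the dimensions of these spaces
to add up to at least `A = N * (nt - R / (b * m))`, and in fact to more than `A`: if they add up to
exactly `A`, the unresolved differences still carry information of the order of a power of
`1 / snr`, unless some `|H d|²` is smaller than a large power of `1 / snr`, and this outweighs the
exponentially small error (`lt_sum_lostDimension_of_outage`). A total dimension of at least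
`κ = ⌊A⌋ + 1` has probability of order `snr ^ (-nr * κ)` up to `ε`
(`channelLaw_nearKernel_le`). Conversely, `κ` columns of squared size of order `1 / snr` cause
outage (`discrete_outage_lower_bound`).
-/

noncomputable section

namespace MIMO

section

/-! ### The complex Gaussian law -/

lemma stdComplexGaussianPDF_pos (z : ℂ) : 0 < stdComplexGaussianPDF z := by
  unfold stdComplexGaussianPDF; positivity

lemma stdComplexGaussianPDF_le (z : ℂ) : stdComplexGaussianPDF z ≤ Real.pi⁻¹ := by
  unfold stdComplexGaussianPDF
  refine mul_le_of_le_one_right (by positivity) (Real.exp_le_one_iff.2 ?_)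
  simp

@[fun_prop]
lemma continuous_stdComplexGaussianPDF : Continuous stdComplexGaussianPDF := by
  unfold stdComplexGaussianPDF; fun_prop

lemma integral_exp_neg_mul_normSq {c : ℝ} (hc : 0 < c) :
    ∫ z : ℂ, Real.exp (-c * ‖z‖ ^ 2) = Real.pi / c := by
  rw [GaussianFourier.integral_rexp_neg_mul_sq_norm hc, Complex.finrank_real_complex]
  norm_num

lemma integrable_exp_neg_mul_normSq {c : ℝ} (hc : 0 < c) :
    Integrable fun z : ℂ => Real.exp (-c * ‖z‖ ^ 2) := by
  refine Integrable.of_integral_ne_zero ?_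
  rw [integral_exp_neg_mul_normSq hc]
  positivity

lemma integrable_stdComplexGaussianPDF : Integrable stdComplexGaussianPDF := by
  have := (integrable_exp_neg_mul_normSq one_pos).const_mul Real.pi⁻¹
  simp only [neg_mul, one_mul] at this
  exact this

lemma integral_stdComplexGaussianPDF : ∫ z, stdComplexGaussianPDF z = 1 := by
  have h := integral_exp_neg_mul_normSq one_pos
  simp only [neg_mul, one_mul, div_one] at h
  simp [stdComplexGaussianPDF, integral_const_mul, h, Real.pi_ne_zero]

instance : IsProbabilityMeasure stdComplexGaussian := by
  refine ⟨?_⟩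
  rw [stdComplexGaussian, withDensity_apply _ MeasurableSet.univ, setLIntegral_univ,
    ← ofReal_integral_eq_lintegral_ofReal integrable_stdComplexGaussianPDF
      (ae_of_all _ fun z => (stdComplexGaussianPDF_pos z).le),
    integral_stdComplexGaussianPDF, ENNReal.ofReal_one]

lemma lintegral_stdComplexGaussian_le (f : ℂ → ENNReal) (hf : Measurable f) :
    ∫⁻ z, f z ∂stdComplexGaussian ≤ ENNReal.ofReal Real.pi⁻¹ * ∫⁻ z, f z := by
  rw [stdComplexGaussian, lintegral_withDensity_eq_lintegral_mul _ (by fun_prop) hf,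
    ← lintegral_const_mul _ hf]
  refine lintegral_mono fun z => ?_
  simp only [Pi.mul_apply]
  gcongr
  exact stdComplexGaussianPDF_le z

lemma stdComplexGaussian_closedBall_le (c : ℂ) {r : ℝ} (hr : 0 ≤ r) :
    stdComplexGaussian (Metric.closedBall c r) ≤ ENNReal.ofReal (r ^ 2) := by
  have h := lintegral_stdComplexGaussian_le ((Metric.closedBall c r).indicator 1)
    (measurable_one.indicator measurableSet_closedBall)
  rw [lintegral_indicator_one measurableSet_closedBall,
    lintegral_indicator_one measurableSet_closedBall, Complex.volume_closedBall] at h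
  refine h.trans (le_of_eq ?_)
  have : (NNReal.pi : ENNReal) = ENNReal.ofReal Real.pi := by
    rw [← NNReal.coe_real_pi, ENNReal.ofReal_coe_nnreal]
  rw [this, ← ENNReal.ofReal_pow hr, mul_comm (ENNReal.ofReal (r ^ 2)), ← mul_assoc,
    ← ENNReal.ofReal_mul (by positivity), inv_mul_cancel₀ Real.pi_ne_zero, ENNReal.ofReal_one,
    one_mul]

lemma le_stdComplexGaussian_closedBall {r : ℝ} (hr : 0 ≤ r) (hr1 : r ≤ 1) :
    ENNReal.ofReal (Real.exp (-1) * r ^ 2) ≤ stdComplexGaussian (Metric.closedBall 0 r) := by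
  have hpi : (NNReal.pi : ENNReal) = ENNReal.ofReal Real.pi := by
    rw [← NNReal.coe_real_pi, ENNReal.ofReal_coe_nnreal]
  rw [stdComplexGaussian, withDensity_apply _ measurableSet_closedBall]
  calc ENNReal.ofReal (Real.exp (-1) * r ^ 2)
      = ∫⁻ _ in Metric.closedBall (0 : ℂ) r, ENNReal.ofReal (Real.pi⁻¹ * Real.exp (-1)) := by
        rw [setLIntegral_const, Complex.volume_closedBall, hpi, ← ENNReal.ofReal_pow hr,
          ← ENNReal.ofReal_mul (by positivity), ← ENNReal.ofReal_mul (by positivity)]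
        congr 1
        field_simp
    _ ≤ _ := by
        refine setLIntegral_mono (by fun_prop) fun z hz => ENNReal.ofReal_le_ofReal ?_
        unfold stdComplexGaussianPDF
        have : ‖z‖ ≤ 1 := (by simpa using hz : ‖z‖ ≤ r).trans hr1
        gcongr
        nlinarith [norm_nonneg z]

lemma integrable_normSq_stdComplexGaussian :
    Integrable (fun z : ℂ => ‖z‖ ^ 2) stdComplexGaussian := by
  rw [stdComplexGaussian, integrable_withDensity_iff (by fun_prop) (by simp)]
  refine ((integrable_exp_neg_mul_normSq (c := 1 / 2) (by norm_num)).const_mul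
    (Real.pi⁻¹ * 2)).mono' (Measurable.aestronglyMeasurable (by fun_prop)) (ae_of_all _ fun z => ?_)
  rw [ENNReal.toReal_ofReal (stdComplexGaussianPDF_pos z).le, Real.norm_of_nonneg
    (mul_nonneg (by positivity) (stdComplexGaussianPDF_pos z).le)]
  unfold stdComplexGaussianPDF
  have h1 : ‖z‖ ^ 2 ≤ 2 * Real.exp (‖z‖ ^ 2 / 2) := by
    linarith [Real.add_one_le_exp (‖z‖ ^ 2 / 2)]
  have h2 : Real.exp (-(1 / 2) * ‖z‖ ^ 2) = Real.exp (‖z‖ ^ 2 / 2) * Real.exp (-‖z‖ ^ 2) := by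
    rw [← Real.exp_add]; ring_nf
  rw [h2]
  calc ‖z‖ ^ 2 * (Real.pi⁻¹ * Real.exp (-‖z‖ ^ 2))
      ≤ 2 * Real.exp (‖z‖ ^ 2 / 2) * (Real.pi⁻¹ * Real.exp (-‖z‖ ^ 2)) := by gcongr
    _ = _ := by ring

/-! ### Gaussian noise with a given mean -/

/-- Density at `y` of the vector `a + Z`, where the entries of `Z` are i.i.d. `N_ℂ(0, 1)`. -/
def noiseDensity {n : ℕ} (a y : Fin n → ℂ) : ℝ := ∏ r, stdComplexGaussianPDF (y r - a r)

/-- Squared Euclidean length. The norm of `Fin n → ℂ` is the supremum norm, hence the explicit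
sum. -/
def normSq {n : ℕ} (a : Fin n → ℂ) : ℝ := ∑ r, ‖a r‖ ^ 2

variable {n : ℕ}

lemma normSq_nonneg (a : Fin n → ℂ) : 0 ≤ normSq a := Finset.sum_nonneg fun _ _ => sq_nonneg _

lemma noiseDensity_eq (a y : Fin n → ℂ) :
    noiseDensity a y = Real.pi⁻¹ ^ n * Real.exp (-normSq (y - a)) := by
  simp [noiseDensity, normSq, stdComplexGaussianPDF, Finset.prod_mul_distrib, ← Real.exp_sum]

lemma noiseDensity_pos (a y : Fin n → ℂ) : 0 < noiseDensity a y :=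
  Finset.prod_pos fun _ _ => stdComplexGaussianPDF_pos _

lemma noiseDensity_le_one (a y : Fin n → ℂ) : noiseDensity a y ≤ 1 :=
  Finset.prod_le_one (fun _ _ => (stdComplexGaussianPDF_pos _).le) fun _ _ =>
    (stdComplexGaussianPDF_le _).trans (inv_le_one_of_one_le₀ (by linarith [Real.pi_gt_three]))

@[fun_prop]
lemma continuous_noiseDensity :
    Continuous fun p : (Fin n → ℂ) × (Fin n → ℂ) => noiseDensity p.1 p.2 := by
  unfold noiseDensity; fun_prop

@[fun_prop]
lemma measurable_noiseDensity_comp {X : Type*} [MeasurableSpace X] {f g : X → Fin n → ℂ}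
    (hf : Measurable f) (hg : Measurable g) : Measurable fun x => noiseDensity (f x) (g x) := by
  have h := continuous_stdComplexGaussianPDF.measurable
  unfold noiseDensity
  refine Finset.measurable_fun_prod _ fun r _ => h.comp ?_
  exact ((measurable_pi_apply r).comp hg).sub ((measurable_pi_apply r).comp hf)

@[fun_prop]
lemma measurable_normSq_comp {X : Type*} [MeasurableSpace X] {f : X → Fin n → ℂ}
    (hf : Measurable f) : Measurable fun x => normSq (f x) := by
  unfold normSq
  exact Finset.measurable_fun_sum _ fun r _ => ((measurable_pi_apply r).comp hf).norm.pow_const 2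

lemma integrable_noiseDensity (a : Fin n → ℂ) : Integrable (noiseDensity a) :=
  Integrable.fintype_prod (f := fun r z => stdComplexGaussianPDF (z - a r)) fun r =>
    integrable_stdComplexGaussianPDF.comp_sub_right (a r)

lemma integral_noiseDensity (a : Fin n → ℂ) : ∫ y, noiseDensity a y = 1 := by
  unfold noiseDensity
  rw [integral_fintype_prod_volume_eq_prod (fun r z => stdComplexGaussianPDF (z - a r))]
  refine Finset.prod_eq_one fun r _ => ?_
  rw [integral_sub_right_eq_self, integral_stdComplexGaussianPDF]

/-- Bhattacharyya product of two Gaussian densities, by completing the square. -/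
lemma sqrt_noiseDensity_mul (a a' y : Fin n → ℂ) :
    √(noiseDensity a y) * √(noiseDensity a' y) =
      noiseDensity (fun r => (a r + a' r) / 2) y * Real.exp (-normSq (a - a') / 4) := by
  rw [← Real.sqrt_mul (noiseDensity_pos _ _).le,
    Real.sqrt_eq_iff_mul_self_eq (mul_pos (noiseDensity_pos _ _) (noiseDensity_pos _ _)).le
      (mul_pos (noiseDensity_pos _ _) (Real.exp_pos _)).le]
  have key : -normSq (y - fun r => (a r + a' r) / 2) + -normSq (a - a') / 4 +
      (-normSq (y - fun r => (a r + a' r) / 2) + -normSq (a - a') / 4) =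
      -normSq (y - a) + -normSq (y - a') := by
    simp only [normSq, ← Finset.sum_neg_distrib, Finset.sum_div, ← Finset.sum_add_distrib]
    refine Finset.sum_congr rfl fun r _ => ?_
    simp only [Pi.sub_apply, ← Complex.normSq_eq_norm_sq, Complex.normSq_apply, Complex.sub_re,
      Complex.sub_im, Complex.add_re, Complex.add_im, Complex.div_ofNat_re, Complex.div_ofNat_im]
    ring
  have hexp := congrArg Real.exp key
  simp only [Real.exp_add] at hexp
  simp only [noiseDensity_eq]
  linear_combination -(Real.pi⁻¹ ^ n) ^ 2 * hexp

/-- The mean of the noise vanishes, by the symmetry `w ↦ -w`. -/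
lemma integrable_noiseDensity_mul_re (a : Fin n → ℂ) (r : Fin n) (v : ℂ) :
    Integrable (fun y => noiseDensity a y * (star (y r - a r) * v).re) ∧
      ∫ y, noiseDensity a y * (star (y r - a r) * v).re = 0 := by
  have h0 : Integrable fun w : Fin n → ℂ => noiseDensity 0 w * (star (w r) * v).re := by
    have hdom : Integrable fun w : Fin n → ℂ =>
        ‖v‖ * (Real.pi⁻¹ ^ n * ∏ r, Real.exp (-(1 / 2) * ‖w r‖ ^ 2)) :=
      ((Integrable.fintype_prod (f := fun (_ : Fin n) (z : ℂ) => Real.exp (-(1 / 2) * ‖z‖ ^ 2))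
        fun _ => integrable_exp_neg_mul_normSq (by norm_num)).const_mul _).const_mul _
    refine hdom.mono' ?_ (ae_of_all _ fun w => ?_)
    · have : Continuous fun w : Fin n → ℂ => noiseDensity 0 w := by fun_prop
      fun_prop
    · have h1 : ‖(star (w r) * v).re‖ ≤ ‖w r‖ * ‖v‖ := by
        refine (Complex.abs_re_le_norm _).trans ?_
        simp
      have h2 : ‖w r‖ ≤ Real.exp (normSq w / 2) := by
        have h3 : ‖w r‖ ^ 2 ≤ normSq w :=
          Finset.single_le_sum (f := fun r => ‖w r‖ ^ 2) (fun _ _ => sq_nonneg _)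
            (Finset.mem_univ r)
        nlinarith [Real.add_one_le_exp (normSq w / 2), sq_nonneg (‖w r‖ - 1)]
      have h4 : ∏ r, Real.exp (-(1 / 2) * ‖w r‖ ^ 2) =
          Real.exp (normSq w / 2) * Real.exp (-normSq w) := by
        rw [← Real.exp_sum, ← Real.exp_add, ← Finset.mul_sum]
        congr 1
        simp only [normSq]
        ring
      rw [norm_mul, Real.norm_of_nonneg (noiseDensity_pos _ _).le, noiseDensity_eq, sub_zero, h4]
      calc Real.pi⁻¹ ^ n * Real.exp (-normSq w) * ‖(star (w r) * v).re‖
          ≤ Real.pi⁻¹ ^ n * Real.exp (-normSq w) * (Real.exp (normSq w / 2) * ‖v‖) := by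
            gcongr
            exact h1.trans (by gcongr)
        _ = _ := by ring
  have hodd : ∫ w : Fin n → ℂ, noiseDensity 0 w * (star (w r) * v).re = 0 := by
    have h := integral_neg_eq_self
      (fun w : Fin n → ℂ => noiseDensity 0 w * (star (w r) * v).re) volume
    have h' : ∀ w : Fin n → ℂ, noiseDensity 0 (-w) * (star ((-w) r) * v).re =
        -(noiseDensity 0 w * (star (w r) * v).re) := fun w => by
      have : noiseDensity 0 (-w) = noiseDensity 0 w := by
        simp [noiseDensity_eq, normSq]
      rw [this]
      simp
      ring
    simp only [h', integral_neg] at h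
    linarith
  have hshift : (fun y => noiseDensity a y * (star (y r - a r) * v).re) =
      fun y => (fun w => noiseDensity 0 w * (star (w r) * v).re) (y - a) := by
    funext y
    simp [noiseDensity]
  rw [hshift]
  refine ⟨h0.comp_sub_right a, ?_⟩
  rw [integral_sub_right_eq_self (fun w : Fin n → ℂ => noiseDensity 0 w * (star (w r) * v).re) a,
    hodd]

end

section

/-! ### Bounds on the information divergence -/

variable {n : ℕ} {X : Type*} [MeasurableSpace X]

lemma noiseDensity_eq_mul_exp (a a' y : Fin n → ℂ) :
    noiseDensity a' y = noiseDensity a y *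
      Real.exp (2 * ∑ r, (star (y r - a r) * (a' r - a r)).re - normSq (a - a')) := by
  rw [noiseDensity_eq, noiseDensity_eq, mul_assoc, ← Real.exp_add]
  congr 2
  simp only [normSq, ← Finset.sum_neg_distrib, Finset.mul_sum, ← Finset.sum_add_distrib,
    ← Finset.sum_sub_distrib]
  refine Finset.sum_congr rfl fun r _ => ?_
  simp only [Pi.sub_apply, ← Complex.normSq_eq_norm_sq, Complex.normSq_apply, Complex.sub_re,
    Complex.sub_im, Complex.mul_re, Complex.star_def, Complex.conj_re, Complex.conj_im]
  ring

lemma normSq_sub_le (a a' : Fin n → ℂ) : normSq (a - a') ≤ 2 * (normSq a + normSq a') := by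
  simp only [normSq, ← Finset.sum_add_distrib, Finset.mul_sum]
  refine Finset.sum_le_sum fun r _ => ?_
  have := norm_sub_le (a r) (a' r)
  rw [Pi.sub_apply]
  nlinarith [sq_nonneg (‖a r‖ - ‖a' r‖), norm_nonneg (a r - a' r)]

lemma integrable_normSq_sub {ν : Measure X} [IsProbabilityMeasure ν] {a : X → Fin n → ℂ}
    (ha : Measurable a) (ha2 : Integrable (fun x => normSq (a x)) ν) (a₀ : Fin n → ℂ) :
    Integrable (fun x => normSq (a₀ - a x)) ν := by
  refine (((integrable_const (normSq a₀)).add ha2).const_mul 2).mono'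
    (Measurable.aestronglyMeasurable ?_) (ae_of_all _ fun x => ?_)
  · exact measurable_normSq_comp (measurable_const.sub ha)
  · rw [Real.norm_of_nonneg (normSq_nonneg _)]
    exact normSq_sub_le _ _

lemma integrable_coord {ν : Measure X} [IsProbabilityMeasure ν] {a : X → Fin n → ℂ}
    (ha : Measurable a) (ha2 : Integrable (fun x => normSq (a x)) ν) (r : Fin n) :
    Integrable (fun x => a x r) ν := by
  refine ((integrable_const (1 : ℝ)).add ha2).mono'
    ((measurable_pi_apply r).comp ha).aestronglyMeasurable (ae_of_all _ fun x => ?_)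
  have : ‖a x r‖ ^ 2 ≤ normSq (a x) :=
    Finset.single_le_sum (f := fun r => ‖a x r‖ ^ 2) (fun _ _ => sq_nonneg _) (Finset.mem_univ r)
  simp only [Pi.add_apply]
  nlinarith [sq_nonneg (‖a x r‖ - 1)]

/-- If a density `p` dominates `exp (-c)` times a mixture of Gaussians whose means `a x` have
law `ν`, then the divergence from `p` of the Gaussian with mean `a₀` exceeds `c` by at most the
mean squared distance from `a₀` to the `a x`: by Jensen's inequality `p` dominates a Gaussian
function around `a₀`. -/
lemma divergence_bounds {ν : Measure X} [IsProbabilityMeasure ν] {a : X → Fin n → ℂ}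
    (ha : Measurable a) (ha2 : Integrable (fun x => normSq (a x)) ν) (a₀ : Fin n → ℂ)
    {p : (Fin n → ℂ) → ℝ} (hp0 : ∀ y, 0 < p y) (hpi : Integrable p)
    (hp1 : ∫ y, p y = 1) {c : ℝ}
    (hc : ∀ y, Real.exp (-c) * ∫ x, noiseDensity (a x) y ∂ν ≤ p y) :
    0 ≤ ∫ y, noiseDensity a₀ y * Real.log (noiseDensity a₀ y / p y) ∧
    ∫ y, noiseDensity a₀ y * Real.log (noiseDensity a₀ y / p y) ≤
      c + ∫ x, normSq (a₀ - a x) ∂ν ∧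
    Integrable fun y => noiseDensity a₀ y * Real.log (noiseDensity a₀ y / p y) := by
  have hd : ∀ r, Integrable (fun x => a x r - a₀ r) ν := fun r =>
    (integrable_coord ha ha2 r).sub (integrable_const _)
  have hN := integrable_normSq_sub ha ha2 a₀
  set δ : Fin n → ℂ := fun r => ∫ x, (a x r - a₀ r) ∂ν with hδ
  set V := ∫ x, normSq (a₀ - a x) ∂ν with hV
  -- `m y` is the mean over `ν` of the log-likelihood ratio
  set m : (Fin n → ℂ) → ℝ := fun y => 2 * ∑ r, (star (y r - a₀ r) * δ r).re - V with hm
  have hre : ∀ (y : Fin n → ℂ) (r : Fin n),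
      Integrable (fun x => (star (y r - a₀ r) * (a x r - a₀ r)).re) ν := fun y r =>
    ((hd r).const_mul _).re
  have hlin : ∀ y : Fin n → ℂ, Integrable
      (fun x => ∑ r, (star (y r - a₀ r) * (a x r - a₀ r)).re) ν := fun y =>
    integrable_finsetSum _ fun r _ => hre y r
  have hu : ∀ y : Fin n → ℂ, Integrable (fun x =>
      2 * ∑ r, (star (y r - a₀ r) * (a x r - a₀ r)).re - normSq (a₀ - a x)) ν := fun y =>
    ((hlin y).const_mul 2).sub hN
  have hum : ∀ y : Fin n → ℂ, ∫ x,
      (2 * ∑ r, (star (y r - a₀ r) * (a x r - a₀ r)).re - normSq (a₀ - a x)) ∂ν = m y := by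
    intro y
    rw [integral_sub ((hlin y).const_mul 2) hN, integral_const_mul,
      integral_finsetSum _ fun r _ => hre y r]
    simp only [hm]
    congr 2
    refine Finset.sum_congr rfl fun r _ => ?_
    have h1 := integral_re ((hd r).const_mul (star (y r - a₀ r)))
    rw [integral_const_mul] at h1
    exact h1
  have hjensen : ∀ y, Real.exp (-c) * (noiseDensity a₀ y * Real.exp (m y)) ≤ p y := by
    intro y
    refine le_trans ?_ (hc y)
    refine mul_le_mul_of_nonneg_left ?_ (Real.exp_pos _).le
    have hFi : Integrable (fun x => noiseDensity (a x) y) ν := by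
      refine (integrable_const (1 : ℝ)).mono' ?_ (ae_of_all _ fun x => ?_)
      · exact (measurable_noiseDensity_comp ha measurable_const).aestronglyMeasurable
      · rw [Real.norm_of_nonneg (noiseDensity_pos _ _).le]
        exact noiseDensity_le_one _ _
    have hus : Integrable (fun x => (2 * ∑ r, (star (y r - a₀ r) * (a x r - a₀ r)).re -
        normSq (a₀ - a x)) - m y) ν := (hu y).sub (integrable_const _)
    have h1 : ∫ x, noiseDensity a₀ y * (Real.exp (m y) *
        (1 + ((2 * ∑ r, (star (y r - a₀ r) * (a x r - a₀ r)).re - normSq (a₀ - a x)) - m y))) ∂ν =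
        noiseDensity a₀ y * Real.exp (m y) := by
      rw [integral_const_mul, integral_const_mul, integral_add (integrable_const _)
        hus, integral_sub (hu y) (integrable_const _), hum y]
      simp
    rw [← h1]
    refine integral_mono ((((integrable_const _).add hus).const_mul _).const_mul _) hFi fun x => ?_
    simp only
    rw [noiseDensity_eq_mul_exp a₀ (a x) y]
    refine mul_le_mul_of_nonneg_left ?_ (noiseDensity_pos _ _).le
    set u := 2 * ∑ r, (star (y r - a₀ r) * (a x r - a₀ r)).re - normSq (a₀ - a x)
    have h2 : Real.exp u = Real.exp (m y) * Real.exp (u - m y) := by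
      rw [← Real.exp_add]; ring_nf
    rw [h2]
    refine mul_le_mul_of_nonneg_left ?_ (Real.exp_pos _).le
    linarith [Real.add_one_le_exp (u - m y)]
  have hup : ∀ y, noiseDensity a₀ y * Real.log (noiseDensity a₀ y / p y) ≤
      noiseDensity a₀ y * (c - m y) := by
    intro y
    refine mul_le_mul_of_nonneg_left ?_ (noiseDensity_pos _ _).le
    have hF := noiseDensity_pos a₀ y
    rw [Real.log_le_iff_le_exp (div_pos hF (hp0 y)), div_le_iff₀ (hp0 y)]
    calc noiseDensity a₀ y = Real.exp (c - m y) *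
          (Real.exp (-c) * (noiseDensity a₀ y * Real.exp (m y))) := by
          have : Real.exp (c - m y) * Real.exp (-c) * Real.exp (m y) = 1 := by
            rw [← Real.exp_add, ← Real.exp_add, Real.exp_eq_one_iff]; ring
          linear_combination -(noiseDensity a₀ y) * this
      _ ≤ _ := mul_le_mul_of_nonneg_left (hjensen y) (Real.exp_pos _).le
  have hlow : ∀ y, noiseDensity a₀ y - p y ≤
      noiseDensity a₀ y * Real.log (noiseDensity a₀ y / p y) := by
    intro y
    have hF := noiseDensity_pos a₀ y
    have h := Real.one_sub_inv_le_log_of_pos (div_pos hF (hp0 y))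
    calc noiseDensity a₀ y - p y =
        noiseDensity a₀ y * (1 - (noiseDensity a₀ y / p y)⁻¹) := by
          field_simp
      _ ≤ _ := mul_le_mul_of_nonneg_left h hF.le
  have hsplit : (fun y => noiseDensity a₀ y * (c - m y)) = fun y =>
      (c + V) * noiseDensity a₀ y -
        2 * ∑ r, noiseDensity a₀ y * (star (y r - a₀ r) * δ r).re := by
    funext y
    simp only [hm, ← Finset.mul_sum]
    ring
  have hI1 := (integrable_noiseDensity a₀).const_mul (c + V)
  have hI2 : Integrable fun y : Fin n → ℂ =>
      ∑ r, noiseDensity a₀ y * (star (y r - a₀ r) * δ r).re :=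
    integrable_finsetSum _ fun r _ => (integrable_noiseDensity_mul_re a₀ r (δ r)).1
  have hUi : Integrable fun y => noiseDensity a₀ y * (c - m y) := by
    rw [hsplit]; exact hI1.sub (hI2.const_mul 2)
  have hUv : ∫ y, noiseDensity a₀ y * (c - m y) = c + V := by
    rw [hsplit, integral_sub hI1 (hI2.const_mul 2), integral_const_mul, integral_const_mul,
      integral_noiseDensity, integral_finsetSum _ fun r _ =>
        (integrable_noiseDensity_mul_re a₀ r (δ r)).1,
      Finset.sum_eq_zero fun r _ => (integrable_noiseDensity_mul_re a₀ r (δ r)).2]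
    ring
  have hLi : Integrable fun y => noiseDensity a₀ y - p y := (integrable_noiseDensity a₀).sub hpi
  have hfi : Integrable fun y => noiseDensity a₀ y * Real.log (noiseDensity a₀ y / p y) := by
    refine integrable_of_le_of_le ?_ (ae_of_all _ hlow) (ae_of_all _ hup) hLi hUi
    have := (integrable_noiseDensity a₀).aestronglyMeasurable.aemeasurable
    exact (this.mul (this.div hpi.aestronglyMeasurable.aemeasurable).log).aestronglyMeasurable
  refine ⟨?_, ?_, hfi⟩
  · have := integral_mono hLi hfi hlow
    rw [integral_sub (integrable_noiseDensity a₀) hpi, integral_noiseDensity, hp1] at this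
    linarith
  · exact (integral_mono hfi hUi hup).trans_eq hUv

end

section

/-! ### Mutual information of a mixture of Gaussians -/

variable {n : ℕ} {X : Type*} [MeasurableSpace X]

/-- Density of `a x + Z` when `x` has law `Q`. -/
def mixtureDensity (Q : Measure X) (a : X → Fin n → ℂ) (y : Fin n → ℂ) : ℝ :=
  ∫ x, noiseDensity (a x) y ∂Q

/-- Information divergence, in nats, of the output given `x` from the output. -/
def divergence (Q : Measure X) (a : X → Fin n → ℂ) (x : X) : ℝ :=
  ∫ y, noiseDensity (a x) y * Real.log (noiseDensity (a x) y / mixtureDensity Q a y)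

/-- Average Bhattacharyya coefficient of two independent inputs; minus its logarithm is the
cutoff rate. -/
def avgBhattacharyya (Q : Measure X) (a : X → Fin n → ℂ) : ℝ :=
  ∫ x, ∫ x', Real.exp (-normSq (a x - a x') / 4) ∂Q ∂Q

variable {Q : Measure X} [IsProbabilityMeasure Q] {a : X → Fin n → ℂ}

lemma measurable_noiseDensity_uncurry (ha : Measurable a) :
    Measurable fun p : X × (Fin n → ℂ) => noiseDensity (a p.1) p.2 :=
  measurable_noiseDensity_comp (ha.comp measurable_fst) measurable_snd

lemma integrable_noiseDensity_left (ha : Measurable a) (y : Fin n → ℂ) :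
    Integrable (fun x => noiseDensity (a x) y) Q := by
  refine (integrable_const (1 : ℝ)).mono' ?_ (ae_of_all _ fun x => ?_)
  · exact (measurable_noiseDensity_comp ha measurable_const).aestronglyMeasurable
  · rw [Real.norm_of_nonneg (noiseDensity_pos _ _).le]
    exact noiseDensity_le_one _ _

lemma integrable_sqrt_noiseDensity_left (ha : Measurable a) (y : Fin n → ℂ) :
    Integrable (fun x => √(noiseDensity (a x) y)) Q := by
  refine (integrable_const (1 : ℝ)).mono' ?_ (ae_of_all _ fun x => ?_)
  · exact (measurable_noiseDensity_comp ha measurable_const).sqrt.aestronglyMeasurable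
  · rw [Real.norm_of_nonneg (Real.sqrt_nonneg _)]
    exact Real.sqrt_le_one.2 (noiseDensity_le_one _ _)

lemma integral_pos_of_pos {f : X → ℝ} (hf : Integrable f Q) (h : ∀ x, 0 < f x) :
    0 < ∫ x, f x ∂Q := by
  rw [integral_pos_iff_support_of_nonneg (fun x => (h x).le) hf]
  have : Function.support f = Set.univ := Set.eq_univ_of_forall fun x => (h x).ne'
  rw [this]
  simp

lemma mixtureDensity_pos (ha : Measurable a) (y : Fin n → ℂ) : 0 < mixtureDensity Q a y :=
  integral_pos_of_pos (integrable_noiseDensity_left ha y) fun _ => noiseDensity_pos _ _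

lemma measurable_mixtureDensity (ha : Measurable a) : Measurable (mixtureDensity Q a) :=
  (StronglyMeasurable.integral_prod_left
    (measurable_noiseDensity_uncurry ha).stronglyMeasurable).measurable

lemma integrable_noiseDensity_prod (ha : Measurable a) :
    Integrable (fun p : X × (Fin n → ℂ) => noiseDensity (a p.1) p.2) (Q.prod volume) := by
  rw [integrable_prod_iff (measurable_noiseDensity_uncurry ha).aestronglyMeasurable]
  refine ⟨ae_of_all _ fun x => integrable_noiseDensity (a x), ?_⟩
  simp only [Real.norm_of_nonneg (noiseDensity_pos _ _).le, integral_noiseDensity]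
  exact integrable_const _

lemma integrable_mixtureDensity (ha : Measurable a) : Integrable (mixtureDensity Q a) :=
  (integrable_noiseDensity_prod ha).integral_prod_right

lemma integral_mixtureDensity (ha : Measurable a) : ∫ y, mixtureDensity Q a y = 1 := by
  unfold mixtureDensity
  rw [← integral_integral_swap (integrable_noiseDensity_prod ha)]
  simp [integral_noiseDensity]

/-- Tonelli's theorem for the Bhattacharyya products of all pairs of inputs. -/
lemma integral_sq_integral_sqrt_noiseDensity (ha : Measurable a) :
    Integrable (fun y => (∫ x, √(noiseDensity (a x) y) ∂Q) ^ 2) ∧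
      ∫ y, (∫ x, √(noiseDensity (a x) y) ∂Q) ^ 2 = avgBhattacharyya Q a := by
  set f : (X × X) × (Fin n → ℂ) → ℝ := fun p =>
    √(noiseDensity (a p.1.1) p.2) * √(noiseDensity (a p.1.2) p.2) with hf
  have hfm : Measurable f := by
    refine Measurable.mul (Measurable.sqrt ?_) (Measurable.sqrt ?_)
    · exact measurable_noiseDensity_comp (ha.comp (measurable_fst.comp measurable_fst))
        measurable_snd
    · exact measurable_noiseDensity_comp (ha.comp (measurable_snd.comp measurable_fst))
        measurable_snd
  have hfy : ∀ q : X × X, ∫ y, f (q, y) = Real.exp (-normSq (a q.1 - a q.2) / 4) := fun q => by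
    simp only [hf, sqrt_noiseDensity_mul]
    rw [integral_mul_const, integral_noiseDensity, one_mul]
  have hem : Measurable fun q : X × X => Real.exp (-normSq (a q.1 - a q.2) / 4) := by
    have : Measurable fun q : X × X => normSq (a q.1 - a q.2) :=
      measurable_normSq_comp ((ha.comp measurable_fst).sub (ha.comp measurable_snd))
    fun_prop
  have hei : Integrable (fun q : X × X => Real.exp (-normSq (a q.1 - a q.2) / 4)) (Q.prod Q) := by
    refine (integrable_const (1 : ℝ)).mono' hem.aestronglyMeasurable (ae_of_all _ fun q => ?_)
    rw [Real.norm_of_nonneg (Real.exp_pos _).le, Real.exp_le_one_iff]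
    linarith [normSq_nonneg (a q.1 - a q.2)]
  have hfi : Integrable f ((Q.prod Q).prod volume) := by
    rw [integrable_prod_iff hfm.aestronglyMeasurable]
    refine ⟨ae_of_all _ fun q => ?_, ?_⟩
    · simp only [hf, sqrt_noiseDensity_mul]
      exact (integrable_noiseDensity _).mul_const _
    · have : ∀ p, ‖f p‖ = f p := fun p => Real.norm_of_nonneg (by positivity)
      simp only [this, hfy]
      exact hei
  have hfx : ∀ y, ∫ q, f (q, y) ∂(Q.prod Q) = (∫ x, √(noiseDensity (a x) y) ∂Q) ^ 2 := fun y => by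
    rw [pow_two]
    exact integral_prod_mul (fun x => √(noiseDensity (a x) y)) fun x => √(noiseDensity (a x) y)
  constructor
  · simpa only [hfx] using hfi.integral_prod_right
  · have h := integral_integral_swap (f := fun q y => f (q, y)) hfi
    simp only [hfy, hfx] at h
    rw [← h, integral_prod _ hei, avgBhattacharyya]

lemma avgBhattacharyya_pos (ha : Measurable a) : 0 < avgBhattacharyya Q a := by
  obtain ⟨hi, h⟩ := integral_sq_integral_sqrt_noiseDensity (Q := Q) ha
  rw [← h, integral_pos_iff_support_of_nonneg (fun y => sq_nonneg _) hi]
  have hs : (Function.support fun y => (∫ x, √(noiseDensity (a x) y) ∂Q) ^ 2) = Set.univ :=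
    Set.eq_univ_of_forall fun y => (pow_pos (integral_pos_of_pos
      (integrable_sqrt_noiseDensity_left ha y) fun x => Real.sqrt_pos.2 (noiseDensity_pos _ _))
        2).ne'
  rw [hs]
  exact Measure.measure_univ_pos.2 (NeZero.ne _)

lemma measurable_divergence (ha : Measurable a) : Measurable (divergence Q a) := by
  refine (StronglyMeasurable.integral_prod_right (f := fun x y => noiseDensity (a x) y *
    Real.log (noiseDensity (a x) y / mixtureDensity Q a y)) ?_).measurable
  have h1 := measurable_noiseDensity_uncurry ha
  have h2 := (measurable_mixtureDensity (Q := Q) ha).comp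
    (measurable_snd : Measurable (Prod.snd : X × (Fin n → ℂ) → _))
  exact (h1.mul (h1.div h2).log).stronglyMeasurable

lemma divergence_bounds_self (ha : Measurable a) (ha2 : Integrable (fun x => normSq (a x)) Q)
    (x : X) : 0 ≤ divergence Q a x ∧
      divergence Q a x ≤ ∫ x', normSq (a x - a x') ∂Q ∧
      Integrable fun y => noiseDensity (a x) y *
        Real.log (noiseDensity (a x) y / mixtureDensity Q a y) := by
  have h := divergence_bounds ha ha2 (a x) (mixtureDensity_pos (Q := Q) ha)
    (integrable_mixtureDensity ha) (integral_mixtureDensity ha) (c := 0)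
    (fun y => by simp [mixtureDensity])
  rw [zero_add] at h
  exact h

lemma integrable_divergence (ha : Measurable a) (ha2 : Integrable (fun x => normSq (a x)) Q) :
    Integrable (divergence Q a) Q := by
  refine (((ha2.add (integrable_const (∫ x, normSq (a x) ∂Q))).const_mul 2)).mono'
    (measurable_divergence ha).aestronglyMeasurable (ae_of_all _ fun x => ?_)
  obtain ⟨h0, h1, -⟩ := divergence_bounds_self ha ha2 x
  rw [Real.norm_of_nonneg h0]
  refine h1.trans ?_
  calc ∫ x', normSq (a x - a x') ∂Q ≤ ∫ x', 2 * (normSq (a x) + normSq (a x')) ∂Q :=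
        integral_mono (integrable_normSq_sub ha ha2 _)
          (((integrable_const _).add ha2).const_mul 2) fun x' => normSq_sub_le _ _
    _ = _ := by
        rw [integral_const_mul, integral_add (integrable_const _) ha2]
        simp

/-- The cutoff rate bounds the mutual information from below. The logarithm is linearized twice:
once at the posterior mean of the square root of the likelihood ratio, once at the density
proportional to the squared mean of the square roots of the likelihoods. -/
lemma neg_log_avgBhattacharyya_le (ha : Measurable a)
    (ha2 : Integrable (fun x => normSq (a x)) Q) :
    -Real.log (avgBhattacharyya Q a) ≤ ∫ x, divergence Q a x ∂Q := by
  set G := avgBhattacharyya Q a with hG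
  set p := mixtureDensity Q a with hp
  set g : (Fin n → ℂ) → ℝ := fun y => ∫ x, √(noiseDensity (a x) y) ∂Q with hg
  have hG0 : 0 < G := avgBhattacharyya_pos ha
  have hp0 : ∀ y, 0 < p y := mixtureDensity_pos ha
  have hg0 : ∀ y, 0 < g y := fun y => integral_pos_of_pos
    (integrable_sqrt_noiseDensity_left ha y) fun x => Real.sqrt_pos.2 (noiseDensity_pos _ _)
  have hpm : Measurable p := measurable_mixtureDensity ha
  have hFm := measurable_noiseDensity_uncurry ha
  have hgm : Measurable g := (StronglyMeasurable.integral_prod_left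
    hFm.sqrt.stronglyMeasurable).measurable
  obtain ⟨hg2i, hg2⟩ := integral_sq_integral_sqrt_noiseDensity (Q := Q) ha
  change Integrable (fun y => g y ^ 2) at hg2i
  change ∫ y, g y ^ 2 = G at hg2
  -- the two functions of the input and the output in the linearized logarithm
  have hBi : Integrable (fun q : X × (Fin n → ℂ) => √(noiseDensity (a q.1) q.2) *
      (p q.2 / g q.2)) (Q.prod volume) := by
    rw [integrable_prod_iff' (Measurable.aestronglyMeasurable (by fun_prop))]
    refine ⟨ae_of_all _ fun y => (integrable_sqrt_noiseDensity_left ha y).mul_const (p y / g y), ?_⟩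
    have : ∀ y, ∫ x, ‖√(noiseDensity (a x) y) * (p y / g y)‖ ∂Q = p y := fun y => by
      simp only [Real.norm_of_nonneg (mul_nonneg (Real.sqrt_nonneg _)
        (div_pos (hp0 y) (hg0 y)).le)]
      rw [integral_mul_const]
      exact mul_div_cancel₀ _ (hg0 y).ne'
    simp only [this]
    exact integrable_mixtureDensity ha
  have hCi : Integrable (fun q : X × (Fin n → ℂ) => noiseDensity (a q.1) q.2 *
      (g q.2 ^ 2 / p q.2)) (Q.prod volume) := by
    rw [integrable_prod_iff' (Measurable.aestronglyMeasurable (by fun_prop))]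
    refine ⟨ae_of_all _ fun y => (integrable_noiseDensity_left ha y).mul_const (g y ^ 2 / p y), ?_⟩
    have : ∀ y, ∫ x, ‖noiseDensity (a x) y * (g y ^ 2 / p y)‖ ∂Q = g y ^ 2 := fun y => by
      simp only [Real.norm_of_nonneg (mul_nonneg (noiseDensity_pos _ _).le
        (div_pos (pow_pos (hg0 y) 2) (hp0 y)).le)]
      rw [integral_mul_const]
      exact mul_div_cancel₀ _ (hp0 y).ne'
    simp only [this]
    exact hg2i
  have hBv : ∫ x, (∫ y, √(noiseDensity (a x) y) * (p y / g y)) ∂Q = 1 := by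
    rw [integral_integral_swap hBi]
    have : ∀ y, ∫ x, √(noiseDensity (a x) y) * (p y / g y) ∂Q = p y := fun y => by
      rw [integral_mul_const]
      exact mul_div_cancel₀ _ (hg0 y).ne'
    simp only [this]
    exact integral_mixtureDensity ha
  have hCv : ∫ x, (∫ y, noiseDensity (a x) y * (g y ^ 2 / p y)) ∂Q = G := by
    rw [integral_integral_swap hCi]
    have : ∀ y, ∫ x, noiseDensity (a x) y * (g y ^ 2 / p y) ∂Q = g y ^ 2 := fun y => by
      rw [integral_mul_const]
      exact mul_div_cancel₀ _ (hp0 y).ne'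
    simp only [this]
    exact hg2
  have hpt : ∀ x y, (3 - Real.log G) * noiseDensity (a x) y -
      2 * (√(noiseDensity (a x) y) * (p y / g y)) -
      G⁻¹ * (noiseDensity (a x) y * (g y ^ 2 / p y)) ≤
      noiseDensity (a x) y * Real.log (noiseDensity (a x) y / p y) := by
    intro x y
    have hF := noiseDensity_pos (a x) y
    set F := noiseDensity (a x) y
    have hs := Real.sqrt_pos.2 hF
    have hsF : √F * √F = F := Real.mul_self_sqrt hF.le
    have hpy := hp0 y
    have hgy := hg0 y
    have h1 := Real.log_le_sub_one_of_pos (div_pos hpy (mul_pos hs hgy))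
    have h2 := Real.log_le_sub_one_of_pos (div_pos (pow_pos hgy 2) (mul_pos hG0 hpy))
    have hlogF : Real.log F = 2 * Real.log √F := by
      rw [Real.log_sqrt hF.le]; ring
    rw [Real.log_div hpy.ne' (mul_pos hs hgy).ne', Real.log_mul hs.ne' hgy.ne'] at h1
    rw [Real.log_div (pow_pos hgy 2).ne' (mul_pos hG0 hpy).ne', Real.log_mul hG0.ne' hpy.ne',
      Real.log_pow] at h2
    rw [Real.log_div hF.ne' hpy.ne']
    have h3 : 3 - Real.log G - 2 * (p y / (√F * g y)) - g y ^ 2 / (G * p y) ≤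
        Real.log F - Real.log (p y) := by
      push_cast at h2
      linarith
    have h4 := mul_le_mul_of_nonneg_left h3 hF.le
    refine le_trans (le_of_eq ?_) h4
    have h5 : F * (p y / (√F * g y)) = √F * (p y / g y) := by
      nth_rewrite 1 [← hsF]
      field_simp
    have h6 : F * (g y ^ 2 / (G * p y)) = G⁻¹ * (F * (g y ^ 2 / p y)) := by
      field_simp
    rw [← h5, ← h6]
    ring
  have hBi' : Integrable (fun x => 2 * ∫ y, √(noiseDensity (a x) y) * (p y / g y)) Q :=
    hBi.integral_prod_left.const_mul 2
  have hCi' : Integrable (fun x => G⁻¹ * ∫ y, noiseDensity (a x) y * (g y ^ 2 / p y)) Q :=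
    hCi.integral_prod_left.const_mul _
  have hABi : Integrable (fun x => (3 - Real.log G) -
      2 * (∫ y, √(noiseDensity (a x) y) * (p y / g y))) Q := (integrable_const _).sub hBi'
  have hLi : Integrable (fun x => (3 - Real.log G) -
      2 * (∫ y, √(noiseDensity (a x) y) * (p y / g y)) -
      G⁻¹ * ∫ y, noiseDensity (a x) y * (g y ^ 2 / p y)) Q :=
    hABi.sub hCi'
  have hle : (fun x => (3 - Real.log G) -
      2 * (∫ y, √(noiseDensity (a x) y) * (p y / g y)) -
      G⁻¹ * ∫ y, noiseDensity (a x) y * (g y ^ 2 / p y)) ≤ᵐ[Q] divergence Q a := by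
    filter_upwards [hBi.prod_right_ae, hCi.prod_right_ae] with x hB hC
    have hA := (integrable_noiseDensity (a x)).const_mul (3 - Real.log G)
    have h := integral_mono ((hA.sub (hB.const_mul 2)).sub (hC.const_mul G⁻¹))
      (divergence_bounds_self (Q := Q) ha ha2 x).2.2 (hpt x)
    refine le_trans (le_of_eq ?_) h
    rw [integral_sub' (hA.sub (hB.const_mul 2)) (hC.const_mul G⁻¹),
      integral_sub' hA (hB.const_mul 2), integral_const_mul, integral_const_mul,
      integral_const_mul, integral_noiseDensity, mul_one]
  have h := integral_mono_ae hLi (integrable_divergence ha ha2) hle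
  refine le_trans (le_of_eq ?_) h
  rw [integral_sub hABi hCi', integral_sub (integrable_const _)
    hBi', integral_const_mul, integral_const_mul, hBv, hCv,
    inv_mul_cancel₀ hG0.ne']
  simp
  ring

end

section

/-! ### Mutual information of one fading block -/

variable {nr nt : ℕ}

/-- Noiseless output of one use of the channel. -/
def fadedInput (snr : ℝ) (H : Fin nr → Fin nt → ℂ) (x : Fin nt → ℂ) : Fin nr → ℂ :=
  fun r => (Real.sqrt (snr / nt) : ℂ) * (Matrix.of H).mulVec x r

lemma measurable_fadedInput (snr : ℝ) (H : Fin nr → Fin nt → ℂ) :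
    Measurable (fadedInput snr H) := by
  refine measurable_pi_lambda _ fun r => measurable_const.mul ?_
  simp only [Matrix.mulVec, dotProduct]
  fun_prop

lemma normSq_fadedInput_sub {snr : ℝ} (hs : 0 ≤ snr) (H : Fin nr → Fin nt → ℂ)
    (x x' : Fin nt → ℂ) : normSq (fadedInput snr H x - fadedInput snr H x') =
      snr / nt * normSq ((Matrix.of H).mulVec (x - x')) := by
  simp only [normSq, fadedInput, Pi.sub_apply, ← mul_sub, Matrix.mulVec_sub, norm_mul, mul_pow,
    Complex.norm_real, Real.norm_eq_abs, sq_abs, Real.sq_sqrt (show 0 ≤ snr / nt by positivity),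
    Finset.mul_sum]

lemma normSq_mulVec_le (H : Fin nr → Fin nt → ℂ) (x : Fin nt → ℂ) :
    normSq ((Matrix.of H).mulVec x) ≤ nt * ∑ r, ∑ j, ‖H r j‖ ^ 2 * ‖x j‖ ^ 2 := by
  rw [normSq, Finset.mul_sum]
  refine Finset.sum_le_sum fun r _ => ?_
  simp only [Matrix.mulVec, dotProduct, Matrix.of_apply]
  have h1 : ‖∑ j, H r j * x j‖ ≤ ∑ j, ‖H r j * x j‖ := norm_sum_le _ _
  have h2 := sq_sum_le_card_mul_sum_sq (s := Finset.univ) (f := fun j => ‖H r j * x j‖)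
  simp only [norm_mul, mul_pow, Finset.card_univ, Fintype.card_fin] at h1 h2
  exact (pow_le_pow_left₀ (norm_nonneg _) h1 2).trans h2

lemma normSq_fadedInput_sub_le {snr : ℝ} (hs : 0 ≤ snr) (hnt : 0 < nt)
    (H : Fin nr → Fin nt → ℂ) (x x' : Fin nt → ℂ) :
    normSq (fadedInput snr H x - fadedInput snr H x') ≤
      snr * ∑ r, ∑ j, ‖H r j‖ ^ 2 * ‖x j - x' j‖ ^ 2 := by
  rw [normSq_fadedInput_sub hs]
  have hnt' : (0 : ℝ) < nt := by exact_mod_cast hnt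
  calc _ ≤ snr / nt * (nt * ∑ r, ∑ j, ‖H r j‖ ^ 2 * ‖(x - x') j‖ ^ 2) := by
        gcongr
        exact normSq_mulVec_le _ _
    _ = _ := by
        rw [← mul_assoc, div_mul_cancel₀ _ hnt'.ne']
        rfl

lemma fadedInput_zero (snr : ℝ) (H : Fin nr → Fin nt → ℂ) : fadedInput snr H 0 = 0 := by
  funext r
  simp [fadedInput]

lemma integrable_normSq_fadedInput {Q : Measure (Fin nt → ℂ)} {snr : ℝ} (hs : 0 ≤ snr) (hnt : 0 < nt)
    (H : Fin nr → Fin nt → ℂ) (hQ : ∀ j, Integrable (fun x => ‖x j‖ ^ 2) Q) :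
    Integrable (fun x => normSq (fadedInput snr H x)) Q := by
  have hi : Integrable (fun x : Fin nt → ℂ => snr * ∑ r, ∑ j, ‖H r j‖ ^ 2 * ‖x j‖ ^ 2) Q :=
    (integrable_finsetSum _ fun r _ => integrable_finsetSum _ fun j _ =>
      (hQ j).const_mul _).const_mul _
  refine hi.mono' (measurable_normSq_comp (measurable_fadedInput _ _)).aestronglyMeasurable
    (ae_of_all _ fun x => ?_)
  rw [Real.norm_of_nonneg (normSq_nonneg _)]
  simpa [fadedInput_zero] using normSq_fadedInput_sub_le hs hnt H x 0

variable {Q : Measure (Fin nt → ℂ)} [IsProbabilityMeasure Q]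

lemma blockMutualInfo_eq (Q : Measure (Fin nt → ℂ)) (snr : ℝ) (H : Fin nr → Fin nt → ℂ) :
    blockMutualInfo Q snr H =
      (∫ x, divergence Q (fadedInput snr H) x ∂Q) / Real.log 2 := by
  rw [← integral_div]
  refine integral_congr_ae (ae_of_all _ fun x => ?_)
  simp only [divergence]
  rw [← integral_div]
  refine integral_congr_ae (ae_of_all _ fun y => ?_)
  simp only [Real.logb, mul_div_assoc]
  rfl

lemma blockMutualInfo_nonneg {snr : ℝ} (hs : 0 ≤ snr) (hnt : 0 < nt)
    (H : Fin nr → Fin nt → ℂ) (hQ : ∀ j, Integrable (fun x => ‖x j‖ ^ 2) Q) :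
    0 ≤ blockMutualInfo Q snr H := by
  rw [blockMutualInfo_eq]
  exact div_nonneg (integral_nonneg fun x => (divergence_bounds_self (measurable_fadedInput _ _)
    (integrable_normSq_fadedInput hs hnt H hQ) x).1) (Real.log_nonneg one_le_two)

lemma neg_log_avgBhattacharyya_le_blockMutualInfo {snr : ℝ} (hs : 0 ≤ snr) (hnt : 0 < nt)
    (H : Fin nr → Fin nt → ℂ) (hQ : ∀ j, Integrable (fun x => ‖x j‖ ^ 2) Q) :
    -Real.log (avgBhattacharyya Q (fadedInput snr H)) ≤
      blockMutualInfo Q snr H * Real.log 2 := by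
  rw [blockMutualInfo_eq, div_mul_cancel₀ _ (Real.log_pos one_lt_two).ne']
  exact neg_log_avgBhattacharyya_le (measurable_fadedInput _ _)
    (integrable_normSq_fadedInput hs hnt H hQ)

lemma blockMutualInfo_le_of_divergence_le {snr : ℝ} (hs : 0 ≤ snr) (hnt : 0 < nt)
    (H : Fin nr → Fin nt → ℂ) (hQ : ∀ j, Integrable (fun x => ‖x j‖ ^ 2) Q)
    {f : (Fin nt → ℂ) → ℝ} (hf : Integrable f Q)
    (h : ∀ᵐ x ∂Q, divergence Q (fadedInput snr H) x ≤ f x) :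
    blockMutualInfo Q snr H * Real.log 2 ≤ ∫ x, f x ∂Q := by
  rw [blockMutualInfo_eq, div_mul_cancel₀ _ (Real.log_pos one_lt_two).ne']
  exact integral_mono_ae (integrable_divergence (measurable_fadedInput _ _)
    (integrable_normSq_fadedInput hs hnt H hQ)) hf h

/-- A weak channel conveys little information, whatever the input. -/
lemma blockMutualInfo_le_of_norm_le {snr η : ℝ} (hs : 0 ≤ snr) (hnt : 0 < nt)
    (H : Fin nr → Fin nt → ℂ) (hQ : ∀ j, Integrable (fun x => ‖x j‖ ^ 2) Q)
    (hη : ∀ r j, ‖H r j‖ ^ 2 ≤ η) :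
    blockMutualInfo Q snr H * Real.log 2 ≤
      snr * η * (nr * ∑ j, 4 * ∫ x, ‖x j‖ ^ 2 ∂Q) := by
  have hterm : ∀ (c : Fin nt → ℝ) (j : Fin nt),
      Integrable (fun x : Fin nt → ℂ => η * (2 * (c j + ‖x j‖ ^ 2))) Q := fun c j =>
    (((integrable_const _).add (hQ j)).const_mul 2).const_mul η
  have hlin : ∀ c : Fin nt → ℝ, Integrable (fun x : Fin nt → ℂ =>
      snr * (nr * ∑ j, η * (2 * (c j + ‖x j‖ ^ 2)))) Q := fun c =>
    ((integrable_finsetSum _ fun j _ => hterm c j).const_mul _).const_mul _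
  have hval : ∀ c : Fin nt → ℝ, ∫ x, snr * (nr * ∑ j, η * (2 * (c j + ‖x j‖ ^ 2))) ∂Q =
      snr * (nr * ∑ j, η * (2 * (c j + ∫ x, ‖x j‖ ^ 2 ∂Q))) := fun c => by
    rw [integral_const_mul, integral_const_mul, integral_finsetSum _ fun j _ =>
      hterm c j]
    congr 3
    funext j
    rw [integral_const_mul, integral_const_mul]
    congr 2
    rw [integral_add (integrable_const _) (hQ j)]
    simp
  refine (blockMutualInfo_le_of_divergence_le hs hnt H hQ
    (hlin fun j => ∫ x, ‖x j‖ ^ 2 ∂Q) (ae_of_all _ fun x => ?_)).trans (le_of_eq ?_)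
  · refine (divergence_bounds_self (measurable_fadedInput _ _)
      (integrable_normSq_fadedInput hs hnt H hQ) x).2.1.trans ?_
    have h1 : ∀ x', normSq (fadedInput snr H x - fadedInput snr H x') ≤
        snr * (nr * ∑ j, η * (2 * (‖x j‖ ^ 2 + ‖x' j‖ ^ 2))) := fun x' => by
      refine (normSq_fadedInput_sub_le hs hnt H x x').trans
        (mul_le_mul_of_nonneg_left ?_ hs)
      calc _ ≤ ∑ _r : Fin nr, ∑ j, η * (2 * (‖x j‖ ^ 2 + ‖x' j‖ ^ 2)) := by
            refine Finset.sum_le_sum fun r _ => Finset.sum_le_sum fun j _ =>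
              mul_le_mul (hη r j) ?_ (sq_nonneg _) ((sq_nonneg _).trans (hη r j))
            have := norm_sub_le (x j) (x' j)
            nlinarith [sq_nonneg (‖x j‖ - ‖x' j‖), norm_nonneg (x j - x' j)]
        _ = _ := by simp
    refine (integral_mono (integrable_normSq_sub (measurable_fadedInput _ _)
      (integrable_normSq_fadedInput hs hnt H hQ) _) (hlin fun j => ‖x j‖ ^ 2) h1).trans ?_
    rw [hval]
    simp only [add_comm]
    exact le_rfl
  · rw [hval]
    simp only [Finset.mul_sum]
    refine Finset.sum_congr rfl fun j _ => ?_
    ring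

/-! ### Gaussian inputs -/

lemma lintegral_pi_le_of_lmarginal_le {ι : Type*} [Fintype ι] [DecidableEq ι] (μ : ι → Measure ℂ)
    [∀ i, IsProbabilityMeasure (μ i)] (J : Finset ι) {f : (ι → ℂ) → ENNReal}
    (hf : Measurable f) {C : ENNReal} (h : ∀ x, lmarginal μ J f x ≤ C) :
    ∫⁻ x, f x ∂(Measure.pi μ) ≤ C := by
  have h1 : ∫⁻ x, f x ∂(Measure.pi μ) ≤ ∫⁻ _, C ∂(Measure.pi μ) := by
    refine lintegral_le_of_lmarginal_le J hf measurable_const fun x => (h x).trans ?_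
    simp [lmarginal]
  simpa using h1

instance (nt : ℕ) : IsProbabilityMeasure (gaussianInput nt) := by
  unfold gaussianInput; infer_instance

lemma integrable_normSq_gaussianInput (nt : ℕ) (j : Fin nt) :
    Integrable (fun x => ‖x j‖ ^ 2) (gaussianInput nt) :=
  (measurePreserving_eval (fun _ : Fin nt => stdComplexGaussian) j).integrable_comp_of_integrable
    integrable_normSq_stdComplexGaussian

/-- Integrating over the input symbol `x j` alone already makes the average Bhattacharyya
coefficient small when `H r j` is large. -/
lemma avgBhattacharyya_gaussianInput_le {snr : ℝ} (hs : 0 < snr) (hnt : 0 < nt)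
    (H : Fin nr → Fin nt → ℂ) (r : Fin nr) (j : Fin nt) (hH : H r j ≠ 0) :
    avgBhattacharyya (gaussianInput nt) (fadedInput snr H) ≤
      4 * nt / (snr * ‖H r j‖ ^ 2) := by
  have hnt' : (0 : ℝ) < nt := by exact_mod_cast hnt
  have hH' : 0 < ‖H r j‖ := norm_pos_iff.2 hH
  set c := snr / nt * ‖H r j‖ ^ 2 / 4 with hc
  have hc0 : 0 < c := by positivity
  have hcv : c⁻¹ = 4 * nt / (snr * ‖H r j‖ ^ 2) := by rw [hc]; field_simp
  have hinner : ∀ x, ∫ x', Real.exp (-normSq (fadedInput snr H x - fadedInput snr H x') / 4)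
      ∂(gaussianInput nt) ≤ c⁻¹ := by
    intro x
    set f : (Fin nt → ℂ) → ℝ := fun x' => Real.exp
      (-normSq (fadedInput snr H x - fadedInput snr H x') / 4) with hf
    have hm : Measurable f := by
      have h : Measurable fun x' => normSq (fadedInput snr H x - fadedInput snr H x') :=
        measurable_normSq_comp (measurable_const.sub (measurable_fadedInput snr H))
      exact (h.neg.div_const 4).exp
    rw [integral_eq_lintegral_of_nonneg_ae (ae_of_all _ fun _ => (Real.exp_pos _).le)
      hm.aestronglyMeasurable]
    refine ENNReal.toReal_le_of_le_ofReal (by positivity) ?_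
    refine lintegral_pi_le_of_lmarginal_le (fun _ => stdComplexGaussian) {j}
      (f := fun x' => ENNReal.ofReal (f x')) hm.ennreal_ofReal fun x' => ?_
    rw [lmarginal_singleton]
    -- the other symbols only move the centre `w` of the Gaussian integral over `x' j`
    set w : ℂ := (H r j)⁻¹ * ∑ i, H r i * (x i - Function.update x' j 0 i) with hw
    have hb : ∀ z, f (Function.update x' j z) ≤ Real.exp (-c * ‖z - w‖ ^ 2) := fun z => by
      rw [hf, Real.exp_le_exp, normSq_fadedInput_sub hs.le]
      have h1 : ‖(Matrix.of H).mulVec (x - Function.update x' j z) r‖ ^ 2 ≤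
          normSq ((Matrix.of H).mulVec (x - Function.update x' j z)) :=
        Finset.single_le_sum (f := fun r => ‖(Matrix.of H).mulVec
          (x - Function.update x' j z) r‖ ^ 2) (fun _ _ => sq_nonneg _) (Finset.mem_univ r)
      have h2 : (Matrix.of H).mulVec (x - Function.update x' j z) r = H r j * (w - z) := by
        rw [hw, mul_sub, ← mul_assoc, mul_inv_cancel₀ hH, one_mul]
        simp only [Matrix.mulVec, dotProduct, Matrix.of_apply, Pi.sub_apply]
        have h3 : H r j * z = ∑ i, if i = j then H r i * z else 0 := by simp
        rw [h3, ← Finset.sum_sub_distrib]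
        refine Finset.sum_congr rfl fun i _ => ?_
        by_cases hi : i = j
        · subst hi; simp [mul_sub]
        · simp [hi]
      rw [h2, norm_mul, mul_pow, norm_sub_rev] at h1
      have h4 := mul_le_mul_of_nonneg_left h1 (show 0 ≤ snr / nt by positivity)
      rw [hc]
      linarith
    calc _ ≤ ∫⁻ z, ENNReal.ofReal (Real.exp (-c * ‖z - w‖ ^ 2)) ∂stdComplexGaussian :=
          lintegral_mono fun z => ENNReal.ofReal_le_ofReal (hb z)
      _ ≤ ENNReal.ofReal Real.pi⁻¹ * ∫⁻ z, ENNReal.ofReal (Real.exp (-c * ‖z - w‖ ^ 2)) :=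
          lintegral_stdComplexGaussian_le _ (by fun_prop)
      _ = ENNReal.ofReal c⁻¹ := by
          rw [← ofReal_integral_eq_lintegral_ofReal
            ((integrable_exp_neg_mul_normSq hc0).comp_sub_right w)
            (ae_of_all _ fun _ => (Real.exp_pos _).le),
            integral_sub_right_eq_self (fun z : ℂ => Real.exp (-c * ‖z‖ ^ 2)) w,
            integral_exp_neg_mul_normSq hc0, ← ENNReal.ofReal_mul (by positivity)]
          congr 1
          field_simp
  rw [← hcv]
  unfold avgBhattacharyya
  calc _ ≤ ∫ _, c⁻¹ ∂(gaussianInput nt) :=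
        integral_mono_of_nonneg (ae_of_all _ fun x => integral_nonneg fun _ => (Real.exp_pos _).le)
          (integrable_const _) (ae_of_all _ hinner)
    _ = c⁻¹ := by simp

end

section

/-! ### Coordinates on a subspace -/

/-- A subspace of dimension `k` is the graph of a linear map over some `k` coordinates: on these
coordinates its vectors are determined, and may be prescribed, freely. -/
lemma exists_coordinates {n : ℕ} (V : Submodule ℂ (Fin n → ℂ)) :
    ∃ J : Finset (Fin n), J.card = Module.finrank ℂ V ∧
      (∀ v ∈ V, (∀ j ∈ J, v j = 0) → v = 0) ∧
      ∀ j ∈ J, ∃ v ∈ V, v j = 1 ∧ ∀ i ∈ J, i ≠ j → v i = 0 := by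
  classical
  obtain ⟨J, hJ⟩ := (Set.toFinite
    {J : Finset (Fin n) | ∀ v ∈ V, (∀ j ∈ J, v j = 0) → v = 0}).exists_minimal
    ⟨Finset.univ, fun v _ h => funext fun j => h j (Finset.mem_univ j)⟩
  have hinj := hJ.prop
  have hdual : ∀ j ∈ J, ∃ v ∈ V, v j = 1 ∧ ∀ i ∈ J, i ≠ j → v i = 0 := by
    intro j hj
    have h1 : ¬ ∀ v ∈ V, (∀ i ∈ J.erase j, v i = 0) → v = 0 := fun h =>
      Finset.notMem_erase j J (hJ.le_of_le h (Finset.erase_subset j J) hj)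
    push Not at h1
    obtain ⟨v, hv, hv0, hne⟩ := h1
    have hvj : v j ≠ 0 := fun h0 => hne (hinj v hv fun i hi => by
      by_cases hij : i = j
      · rw [hij, h0]
      · exact hv0 i (Finset.mem_erase.2 ⟨hij, hi⟩))
    refine ⟨(v j)⁻¹ • v, V.smul_mem _ hv, by simp [hvj], fun i hi hij => ?_⟩
    simp [hv0 i (Finset.mem_erase.2 ⟨hij, hi⟩)]
  refine ⟨J, ?_, hinj, hdual⟩
  let f : V →ₗ[ℂ] (J → ℂ) :=
    LinearMap.pi fun j => (LinearMap.proj (j : Fin n)).comp V.subtype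
  have hf : Function.Bijective f := by
    constructor
    · rw [← LinearMap.ker_eq_bot, LinearMap.ker_eq_bot']
      intro v hv
      exact Subtype.ext (hinj v v.2 fun j hj => congrFun hv ⟨j, hj⟩)
    · intro c
      choose! w hwV hw1 hw0 using hdual
      refine ⟨∑ j : J, c j • ⟨w j, hwV j j.2⟩, funext fun i => ?_⟩
      have : f (∑ j : J, c j • ⟨w j, hwV j j.2⟩) i = ∑ j : J, c j * w j i := by
        simp [f]
      rw [this, Finset.sum_eq_single i]
      · simp [hw1 i i.2]
      · intro j _ hji
        rw [hw0 j j.2 i i.2 fun h => hji (Subtype.ext h.symm), mul_zero]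
      · simp
  rw [LinearEquiv.finrank_eq (LinearEquiv.ofBijective f hf)]
  simp

/-! ### Discrete inputs -/

/-- The vectors with all entries in `𝒳`. -/
def codebook (nt : ℕ) (𝒳 : Finset ℂ) : Finset (Fin nt → ℂ) := Fintype.piFinset fun _ => 𝒳

lemma mem_codebook {nt : ℕ} {𝒳 : Finset ℂ} {x : Fin nt → ℂ} :
    x ∈ codebook nt 𝒳 ↔ ∀ j, x j ∈ 𝒳 := Fintype.mem_piFinset

lemma card_codebook (nt : ℕ) (𝒳 : Finset ℂ) : (codebook nt 𝒳).card = 𝒳.card ^ nt := by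
  simp [codebook]

lemma discreteInput_eq (nt : ℕ) (𝒳 : Finset ℂ) :
    discreteInput nt 𝒳 = uniformOn (codebook nt 𝒳 : Set (Fin nt → ℂ)) := by
  rw [discreteInput]
  congr 1
  ext x
  simp [mem_codebook]

section UniformOn

variable {α : Type*} [MeasurableSpace α] [MeasurableSingletonClass α]

lemma ae_mem_uniformOn (s : Finset α) : ∀ᵐ x ∂(uniformOn (s : Set α)), x ∈ s :=
  ae_cond_mem s.measurableSet

lemma integrable_uniformOn (s : Finset α) (f : α → ℝ) :
    Integrable f (uniformOn (s : Set α)) := by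
  have h : (uniformOn (s : Set α)).restrict s = uniformOn (s : Set α) :=
    Measure.restrict_eq_self_of_ae_mem (ae_mem_uniformOn s)
  rw [← h]
  exact IntegrableOn.finset

lemma integral_uniformOn (s : Finset α) (f : α → ℝ) :
    ∫ x, f x ∂(uniformOn (s : Set α)) = (s.card : ℝ)⁻¹ * ∑ x ∈ s, f x := by
  classical
  have h : (uniformOn (s : Set α)).restrict s = uniformOn (s : Set α) :=
    Measure.restrict_eq_self_of_ae_mem (ae_mem_uniformOn s)
  rw [← h, setIntegral_finset _ IntegrableOn.finset, Finset.mul_sum]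
  refine Finset.sum_congr rfl fun x hx => ?_
  have : (uniformOn (s : Set α)).real {x} = (s.card : ℝ)⁻¹ := by
    rw [measureReal_def, ← Finset.coe_singleton, uniformOn_apply_finset,
      Finset.inter_singleton_of_mem hx]
    simp
  rw [this, smul_eq_mul]

end UniformOn

variable {nr nt : ℕ} {𝒳 : Finset ℂ}

lemma codebook_nonempty (h𝒳 : 𝒳.Nonempty) : (codebook nt 𝒳).Nonempty := by
  obtain ⟨z, hz⟩ := h𝒳
  exact ⟨fun _ => z, mem_codebook.2 fun _ => hz⟩

lemma isProbabilityMeasure_discreteInput (h𝒳 : 𝒳.Nonempty) :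
    IsProbabilityMeasure (discreteInput nt 𝒳) := by
  rw [discreteInput_eq]
  exact isProbabilityMeasure_uniformOn (Finset.finite_toSet _) (codebook_nonempty h𝒳)

lemma integrable_discreteInput (f : (Fin nt → ℂ) → ℝ) : Integrable f (discreteInput nt 𝒳) := by
  rw [discreteInput_eq]
  exact integrable_uniformOn _ _

/-- If the columns of `H` in `J` are weak, then only the symbols outside `J` convey
information: the output density dominates its conditional expectation given these symbols. -/
lemma blockMutualInfo_discreteInput_le {snr η Δ : ℝ} (hs : 0 ≤ snr) (hnt : 0 < nt)
    (h𝒳 : 𝒳.Nonempty) (hΔ : ∀ u ∈ 𝒳, ∀ v ∈ 𝒳, ‖u - v‖ ^ 2 ≤ Δ) (H : Fin nr → Fin nt → ℂ)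
    (J : Finset (Fin nt)) (hη : ∀ r, ∀ j ∈ J, ‖H r j‖ ^ 2 ≤ η) (hη0 : 0 ≤ η) :
    blockMutualInfo (discreteInput nt 𝒳) snr H * Real.log 2 ≤
      ((nt : ℝ) - J.card) * Real.log 𝒳.card + snr * (nr * (nt * (η * Δ))) := by
  classical
  have := isProbabilityMeasure_discreteInput (nt := nt) h𝒳
  have hM : (0 : ℝ) < 𝒳.card := by exact_mod_cast h𝒳.card_pos
  have hΔ0 : 0 ≤ Δ := by
    obtain ⟨z, hz⟩ := h𝒳
    simpa using hΔ z hz z hz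
  refine (blockMutualInfo_le_of_divergence_le hs hnt H (fun j => integrable_discreteInput _)
    (integrable_const (((nt : ℝ) - J.card) * Real.log 𝒳.card + snr * (nr * (nt * (η * Δ)))))
    ?_).trans_eq (by simp)
  have hae : ∀ᵐ x ∂(discreteInput nt 𝒳), x ∈ codebook nt 𝒳 := by
    rw [discreteInput_eq]
    exact ae_mem_uniformOn _
  filter_upwards [hae] with x hx
  rw [mem_codebook] at hx
  set fib : Finset (Fin nt → ℂ) := Fintype.piFinset fun j => if j ∈ J then 𝒳 else {x j} with hfib
  have hmem : ∀ x' ∈ fib, (∀ j, x' j ∈ 𝒳) ∧ ∀ j ∉ J, x' j = x j := by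
    intro x' hx'
    rw [hfib, Fintype.mem_piFinset] at hx'
    refine ⟨fun j => ?_, fun j hj => by simpa [hj] using hx' j⟩
    by_cases hj : j ∈ J
    · simpa [hj] using hx' j
    · have : x' j = x j := by simpa [hj] using hx' j
      rw [this]
      exact hx j
  have hxfib : x ∈ fib := by
    rw [hfib, Fintype.mem_piFinset]
    intro j
    split_ifs
    · exact hx j
    · exact Finset.mem_singleton_self _
  have hcard : (fib.card : ℝ) = (𝒳.card : ℝ) ^ J.card := by
    rw [hfib, Fintype.card_piFinset]
    have : ∀ j, (if j ∈ J then 𝒳 else {x j}).card = if j ∈ J then 𝒳.card else 1 := fun j => by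
      split_ifs <;> simp
    simp only [this, Finset.prod_ite_mem, Finset.univ_inter, Finset.prod_const]
    push_cast
    rfl
  have hP : IsProbabilityMeasure (uniformOn (fib : Set (Fin nt → ℂ))) :=
    isProbabilityMeasure_uniformOn (Finset.finite_toSet _) ⟨x, hxfib⟩
  have hma := measurable_fadedInput snr H
  have hdom : ∀ y, Real.exp (-(((nt : ℝ) - J.card) * Real.log 𝒳.card)) *
      ∫ x', noiseDensity (fadedInput snr H x') y ∂(uniformOn (fib : Set (Fin nt → ℂ))) ≤
      mixtureDensity (discreteInput nt 𝒳) (fadedInput snr H) y := by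
    intro y
    rw [mixtureDensity, discreteInput_eq, integral_uniformOn, integral_uniformOn, hcard,
      card_codebook]
    have hexp : Real.exp (-(((nt : ℝ) - J.card) * Real.log 𝒳.card)) =
        ((𝒳.card : ℝ) ^ nt)⁻¹ * (𝒳.card : ℝ) ^ J.card := by
      rw [neg_mul_eq_neg_mul, neg_sub, sub_mul, Real.exp_sub, ← Real.log_pow, ← Real.log_pow,
        Real.exp_log (by positivity), Real.exp_log (by positivity)]
      ring
    rw [hexp, mul_assoc, mul_inv_cancel_left₀ (by positivity)]
    push_cast
    refine mul_le_mul_of_nonneg_left (Finset.sum_le_sum_of_subset_of_nonneg ?_ fun _ _ _ =>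
      (noiseDensity_pos _ _).le) (by positivity)
    exact fun x' hx' => mem_codebook.2 (hmem x' hx').1
  have h := (divergence_bounds hma (integrable_uniformOn fib _) (fadedInput snr H x)
    (mixtureDensity_pos (Q := discreteInput nt 𝒳) hma) (integrable_mixtureDensity hma)
    (integral_mixtureDensity hma) hdom).2.1
  refine h.trans (add_le_add_right ?_ _)
  rw [integral_uniformOn]
  have hle : ∀ x' ∈ fib, normSq (fadedInput snr H x - fadedInput snr H x') ≤
      snr * (nr * (nt * (η * Δ))) := by
    intro x' hx'
    refine (normSq_fadedInput_sub_le hs hnt H x x').trans (mul_le_mul_of_nonneg_left ?_ hs)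
    calc _ ≤ ∑ _r : Fin nr, ∑ _j : Fin nt, η * Δ := by
          refine Finset.sum_le_sum fun r _ => Finset.sum_le_sum fun j _ => ?_
          by_cases hj : j ∈ J
          · exact mul_le_mul (hη r j hj) (hΔ _ (hx j) _ ((hmem x' hx').1 j)) (sq_nonneg _) hη0
          · rw [(hmem x' hx').2 j hj]
            simp only [sub_self, norm_zero, ne_eq, OfNat.ofNat_ne_zero, not_false_eq_true,
              zero_pow, mul_zero]
            positivity
      _ = _ := by simp
  have hcpos : (0 : ℝ) < fib.card := by exact_mod_cast Finset.card_pos.2 ⟨x, hxfib⟩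
  rw [inv_mul_le_iff₀ hcpos]
  simpa using Finset.sum_le_sum hle

/-- An affine subspace of dimension `k` contains at most `|𝒳| ^ k` points of the codebook. -/
lemma card_codebook_filter_sub_mem_le (V : Submodule ℂ (Fin nt → ℂ)) (x : Fin nt → ℂ)
    [DecidablePred fun x' => x - x' ∈ V] :
    ((codebook nt 𝒳).filter fun x' => x - x' ∈ V).card ≤ 𝒳.card ^ Module.finrank ℂ V := by
  obtain ⟨J, hJ, hinj, -⟩ := exists_coordinates V
  rw [← hJ]
  have hc : (Fintype.piFinset fun _ : J => 𝒳).card = 𝒳.card ^ J.card := by simp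
  rw [← hc]
  refine Finset.card_le_card_of_injOn (fun x' (j : J) => x' j) ?_ ?_
  · intro x' hx'
    have := (Finset.mem_filter.1 (Finset.mem_coe.1 hx')).1
    exact Finset.mem_coe.2 (Fintype.mem_piFinset.2 fun j => mem_codebook.1 this j)
  · intro x₁ h₁ x₂ h₂ h
    have hV := V.sub_mem (Finset.mem_filter.1 (Finset.mem_coe.1 h₂)).2
      (Finset.mem_filter.1 (Finset.mem_coe.1 h₁)).2
    rw [sub_sub_sub_cancel_left] at hV
    have := hinj _ hV fun j hj => by simpa [sub_eq_zero] using congrFun h ⟨j, hj⟩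
    exact sub_eq_zero.1 this

/-- If inputs with difference outside `V` are separated by the channel up to `e`, then the cutoff
rate loses at most `finrank V` symbols, up to `e`. If some pair of inputs with difference in `V`
is separated by `ξ`, then the loss is smaller by a multiple of `ξ`. -/
lemma log_avgBhattacharyya_discreteInput_le {snr e ξ : ℝ}
    (h𝒳 : 𝒳.Nonempty) (H : Fin nr → Fin nt → ℂ)
    (V : Submodule ℂ (Fin nt → ℂ)) (he : 0 ≤ e) (hξ : 0 ≤ ξ)
    (hV : ∀ x ∈ codebook nt 𝒳, ∀ x' ∈ codebook nt 𝒳, x - x' ∉ V →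
      Real.exp (-normSq (fadedInput snr H x - fadedInput snr H x') / 4) ≤ e)
    {x₀ x₁ : Fin nt → ℂ} (hx₀ : x₀ ∈ codebook nt 𝒳) (hx₁ : x₁ ∈ codebook nt 𝒳)
    (h₀₁ : x₀ - x₁ ∈ V)
    (hξe : Real.exp (-normSq (fadedInput snr H x₀ - fadedInput snr H x₁) / 4) ≤ 1 - ξ) :
    Real.log (avgBhattacharyya (discreteInput nt 𝒳) (fadedInput snr H)) ≤
      ((Module.finrank ℂ V : ℝ) - nt) * Real.log 𝒳.card +
        ((𝒳.card : ℝ) ^ nt * e - ξ / (𝒳.card : ℝ) ^ (2 * nt)) := by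
  classical
  have := isProbabilityMeasure_discreteInput (nt := nt) h𝒳
  set k := Module.finrank ℂ V with hk
  set M : ℝ := (𝒳.card : ℝ) with hMdef
  have hM1 : 1 ≤ M := by rw [hMdef]; exact_mod_cast h𝒳.card_pos
  have hM : 0 < M := by linarith
  have hkn : k ≤ nt := by simpa using Submodule.finrank_le V
  set G := avgBhattacharyya (discreteInput nt 𝒳) (fadedInput snr H) with hG
  have hG0 : 0 < G := avgBhattacharyya_pos (measurable_fadedInput _ _)
  set C := codebook nt 𝒳 with hC
  have hcard : (C.card : ℝ) = M ^ nt := by rw [hC, card_codebook]; push_cast; rfl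
  have hGsum : G = (M ^ nt)⁻¹ * ∑ x ∈ C, (M ^ nt)⁻¹ * ∑ x' ∈ C,
      Real.exp (-normSq (fadedInput snr H x - fadedInput snr H x') / 4) := by
    rw [hG, avgBhattacharyya, discreteInput_eq]
    simp only [integral_uniformOn, ← hC, hcard]
  have hpair : ∀ x ∈ C, ∀ x' ∈ C,
      Real.exp (-normSq (fadedInput snr H x - fadedInput snr H x') / 4) ≤
      (if x - x' ∈ V then 1 else 0) + e - (if x = x₀ then if x' = x₁ then ξ else 0 else 0) := by
    intro x hx x' hx'
    by_cases h0 : x = x₀ ∧ x' = x₁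
    · rw [h0.1, h0.2]
      simp only [h₀₁, if_true]
      linarith
    · have hz : (if x = x₀ then if x' = x₁ then ξ else 0 else 0) = 0 := by
        rcases not_and_or.1 h0 with h | h <;> simp [h]
      rw [hz, sub_zero]
      split_ifs with hxV
      · have : Real.exp (-normSq (fadedInput snr H x - fadedInput snr H x') / 4) ≤ 1 := by
          rw [Real.exp_le_one_iff]
          linarith [normSq_nonneg (fadedInput snr H x - fadedInput snr H x')]
        linarith
      · linarith [hV x hx x' hx' hxV]
  have hrow : ∀ x ∈ C, ∑ x' ∈ C,
      Real.exp (-normSq (fadedInput snr H x - fadedInput snr H x') / 4) ≤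
      M ^ k + M ^ nt * e - (if x = x₀ then ξ else 0) := by
    intro x hx
    refine (Finset.sum_le_sum (hpair x hx)).trans ?_
    rw [Finset.sum_sub_distrib, Finset.sum_add_distrib, Finset.sum_boole]
    have h1 : ((C.filter fun x' => x - x' ∈ V).card : ℝ) ≤ M ^ k := by
      rw [hMdef]
      exact_mod_cast card_codebook_filter_sub_mem_le V x
    have h2 : ∑ x' ∈ C, (if x = x₀ then if x' = x₁ then ξ else 0 else 0) =
        if x = x₀ then ξ else 0 := by
      split_ifs
      · rw [Finset.sum_ite_eq' C x₁ fun _ => ξ, if_pos hx₁]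
      · simp
    rw [h2, Finset.sum_const, nsmul_eq_mul, hcard]
    linarith
  have hGle : G ≤ M ^ k / M ^ nt + e - ξ / M ^ (2 * nt) := by
    rw [hGsum, ← Finset.mul_sum]
    have h1 := Finset.sum_le_sum hrow
    rw [Finset.sum_sub_distrib, Finset.sum_const, nsmul_eq_mul, hcard,
      Finset.sum_ite_eq' C x₀ fun _ => ξ, if_pos hx₀] at h1
    calc _ ≤ (M ^ nt)⁻¹ * ((M ^ nt)⁻¹ * (M ^ nt * (M ^ k + M ^ nt * e) - ξ)) := by gcongr
      _ = _ := by
          rw [two_mul, pow_add]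
          field_simp
  have hMnt : M ^ nt = M ^ (nt - k) * M ^ k := by rw [← pow_add, Nat.sub_add_cancel hkn]
  have hlog : Real.log G = ((k : ℝ) - nt) * Real.log M + Real.log (M ^ (nt - k) * G) := by
    rw [Real.log_mul (by positivity) hG0.ne', Real.log_pow, Nat.cast_sub hkn]
    ring
  rw [hlog]
  refine add_le_add_right ?_ _
  have h2 := Real.log_le_sub_one_of_pos (show 0 < M ^ (nt - k) * G by positivity)
  have h3 : M ^ (nt - k) * G ≤ M ^ (nt - k) * (M ^ k / M ^ nt + e - ξ / M ^ (2 * nt)) := by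
    gcongr
  have h4 : M ^ (nt - k) * (M ^ k / M ^ nt + e - ξ / M ^ (2 * nt)) =
      1 + M ^ (nt - k) * e - M ^ (nt - k) * (ξ / M ^ (2 * nt)) := by
    have : M ^ (nt - k) * (M ^ k / M ^ nt) = 1 := by
      rw [hMnt]
      field_simp
    linear_combination this
  have h5 : M ^ (nt - k) * e ≤ M ^ nt * e :=
    mul_le_mul_of_nonneg_right (pow_le_pow_right₀ hM1 (Nat.sub_le _ _)) he
  have h6 : 1 * (ξ / M ^ (2 * nt)) ≤ M ^ (nt - k) * (ξ / M ^ (2 * nt)) :=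
    mul_le_mul_of_nonneg_right (one_le_pow₀ hM1) (by positivity)
  linarith

end

section

/-! ### Small-ball probabilities of the channel -/

variable {N nr nt : ℕ}

instance : IsProbabilityMeasure (channelLaw N nr nt) := by
  unfold channelLaw; infer_instance

lemma channelLaw_pi (s : Fin N → Fin nr → Fin nt → Set ℂ) :
    channelLaw N nr nt {H | ∀ i r j, H i r j ∈ s i r j} =
      ∏ i, ∏ r, ∏ j, stdComplexGaussian (s i r j) := by
  have h : {H : Fin N → Fin nr → Fin nt → ℂ | ∀ i r j, H i r j ∈ s i r j} =
      Set.univ.pi fun i => Set.univ.pi fun r => Set.univ.pi (s i r) := by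
    ext H
    simp
  rw [h, channelLaw, Measure.pi_pi]
  simp only [Measure.pi_pi]

lemma norm_dotProduct_le_of_mem_span {n : ℕ} (S : Finset (Fin n → ℂ)) {v : Fin n → ℂ}
    (hv : v ∈ Submodule.span ℂ (S : Set (Fin n → ℂ))) :
    ∃ C : ℝ, 0 ≤ C ∧ ∀ (h : Fin n → ℂ) (ε : ℝ), 0 ≤ ε → (∀ d ∈ S, ‖h ⬝ᵥ d‖ ≤ ε) →
      ‖h ⬝ᵥ v‖ ≤ C * ε := by
  induction hv using Submodule.span_induction with
  | mem d hd => exact ⟨1, zero_le_one, fun h ε _ hS => by simpa using hS d hd⟩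
  | zero => exact ⟨0, le_rfl, fun h ε hε _ => by simp⟩
  | add u v _ _ hu hv =>
    obtain ⟨A, hA, hA'⟩ := hu
    obtain ⟨B, hB, hB'⟩ := hv
    refine ⟨A + B, add_nonneg hA hB, fun h ε hε hS => ?_⟩
    rw [dotProduct_add, add_mul]
    exact (norm_add_le _ _).trans (add_le_add (hA' h ε hε hS) (hB' h ε hε hS))
  | smul c v _ hv =>
    obtain ⟨B, hB, hB'⟩ := hv
    refine ⟨‖c‖ * B, mul_nonneg (norm_nonneg _) hB, fun h ε hε hS => ?_⟩
    rw [dotProduct_smul, smul_eq_mul, norm_mul, mul_assoc]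
    exact mul_le_mul_of_nonneg_left (hB' h ε hε hS) (norm_nonneg _)

/-- A Gaussian row nearly orthogonal to `S` has as many constrained coordinates as the span of `S`
has dimensions; each of them lies in a small ball whose centre depends on the other entries. -/
lemma pi_stdComplexGaussian_small_le {n : ℕ} (S : Finset (Fin n → ℂ)) :
    ∃ K : ℝ, 0 ≤ K ∧ ∀ t : ℝ, 0 ≤ t →
      Measure.pi (fun _ : Fin n => stdComplexGaussian) {h | ∀ d ∈ S, ‖h ⬝ᵥ d‖ ^ 2 ≤ t} ≤
        ENNReal.ofReal
          (K * t ^ Module.finrank ℂ (Submodule.span ℂ (S : Set (Fin n → ℂ)))) := by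
  classical
  obtain ⟨J, hJ, -, hdual⟩ := exists_coordinates (Submodule.span ℂ (S : Set (Fin n → ℂ)))
  choose! v hvV hv1 hv0 using hdual
  have hC : ∀ j ∈ J, ∃ C : ℝ, 0 ≤ C ∧ ∀ (h : Fin n → ℂ) (ε : ℝ), 0 ≤ ε →
      (∀ d ∈ S, ‖h ⬝ᵥ d‖ ≤ ε) → ‖h ⬝ᵥ v j‖ ≤ C * ε := fun j hj =>
    norm_dotProduct_le_of_mem_span S (hvV j hj)
  choose! C hC0 hC1 using hC
  refine ⟨∏ j : J, C j ^ 2, Finset.prod_nonneg fun _ _ => sq_nonneg _, fun t ht => ?_⟩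
  set A : Set (Fin n → ℂ) := {h | ∀ d ∈ S, ‖h ⬝ᵥ d‖ ^ 2 ≤ t} with hA
  have hAm : MeasurableSet A := by
    have : A = ⋂ d ∈ S, {h | ‖h ⬝ᵥ d‖ ^ 2 ≤ t} := by ext h; simp [hA]
    rw [this]
    refine Finset.measurableSet_biInter _ fun d _ => ?_
    simp only [dotProduct]
    exact measurableSet_le (by fun_prop) measurable_const
  rw [← lintegral_indicator_one hAm]
  refine lintegral_pi_le_of_lmarginal_le (fun _ => stdComplexGaussian) J
    (measurable_one.indicator hAm) fun x => ?_
  -- the part of `h ⬝ᵥ v j` that does not depend on the coordinates in `J`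
  set w : Fin n → ℂ := fun j => ∑ i, if i ∈ J then 0 else x i * v j i with hw
  have hdot : ∀ (y : J → ℂ) (j : J), Function.updateFinset x J y ⬝ᵥ v j = y j + w j := by
    intro y j
    have hyj : y j = ∑ i, if i = (j : Fin n) then y j else 0 := by simp
    rw [hyj, hw, ← Finset.sum_add_distrib]
    simp only [dotProduct, Function.updateFinset]
    refine Finset.sum_congr rfl fun i _ => ?_
    by_cases hi : i ∈ J
    · by_cases hij : i = j
      · subst hij
        simp [hi, hv1 _ hi]
      · simp [hi, hij, hv0 j j.2 i hi hij]
    · have hij : i ≠ j := fun h => hi (h ▸ j.2)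
      simp [hi, hij]
  have hsub : ∀ y : J → ℂ, A.indicator (1 : (Fin n → ℂ) → ENNReal)
      (Function.updateFinset x J y) ≤
      (Set.univ.pi fun j : J => Metric.closedBall (-w j) (C j * √t)).indicator 1 y := by
    intro y
    by_cases hy : Function.updateFinset x J y ∈ A
    · rw [Set.indicator_of_mem hy, Set.indicator_of_mem]
      · exact le_rfl
      intro j _
      rw [mem_closedBall_iff_norm, sub_neg_eq_add, ← hdot]
      refine hC1 j j.2 _ _ (Real.sqrt_nonneg _) fun d hd => ?_
      exact Real.le_sqrt_of_sq_le (hy d hd)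
    · rw [Set.indicator_of_notMem hy]
      exact zero_le
  rw [lmarginal]
  calc _ ≤ ∫⁻ y, (Set.univ.pi fun j : J => Metric.closedBall (-w j) (C j * √t)).indicator 1 y
        ∂(Measure.pi fun _ : J => stdComplexGaussian) := lintegral_mono hsub
    _ = ∏ j : J, stdComplexGaussian (Metric.closedBall (-w j) (C j * √t)) := by
        rw [lintegral_indicator_one (MeasurableSet.univ_pi fun _ => measurableSet_closedBall),
          Measure.pi_pi]
    _ ≤ ∏ j : J, ENNReal.ofReal (C j ^ 2 * t) := by
        refine Finset.prod_le_prod' fun j _ => ?_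
        refine (stdComplexGaussian_closedBall_le _
          (mul_nonneg (hC0 j j.2) (Real.sqrt_nonneg _))).trans_eq ?_
        rw [mul_pow, Real.sq_sqrt ht]
    _ = _ := by
        rw [← ENNReal.ofReal_prod_of_nonneg fun j _ => mul_nonneg (sq_nonneg _) ht,
          Finset.prod_mul_distrib, Finset.prod_const, ← hJ]
        simp

lemma channelLaw_small_le (S : Fin N → Finset (Fin nt → ℂ)) :
    ∃ K : ℝ, 0 ≤ K ∧ ∀ t : ℝ, 0 ≤ t →
      channelLaw N nr nt {H | ∀ i, ∀ d ∈ S i, normSq ((Matrix.of (H i)).mulVec d) ≤ t} ≤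
        ENNReal.ofReal (K * t ^ (nr * ∑ i, Module.finrank ℂ
          (Submodule.span ℂ (S i : Set (Fin nt → ℂ))))) := by
  choose K hK0 hK using fun i => pi_stdComplexGaussian_small_le (S i)
  refine ⟨∏ i, K i ^ nr, Finset.prod_nonneg fun i _ => pow_nonneg (hK0 i) _, fun t ht => ?_⟩
  have hsub : {H : Fin N → Fin nr → Fin nt → ℂ |
      ∀ i, ∀ d ∈ S i, normSq ((Matrix.of (H i)).mulVec d) ≤ t} ⊆
      Set.univ.pi fun i => Set.univ.pi fun _ => {h | ∀ d ∈ S i, ‖h ⬝ᵥ d‖ ^ 2 ≤ t} := by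
    intro H hH i _ r _ d hd
    refine le_trans ?_ (hH i d hd)
    exact Finset.single_le_sum (f := fun r => ‖(Matrix.of (H i)).mulVec d r‖ ^ 2)
      (fun _ _ => sq_nonneg _) (Finset.mem_univ r)
  refine (measure_mono hsub).trans ?_
  rw [channelLaw, Measure.pi_pi]
  simp only [Measure.pi_pi, Finset.prod_const, Finset.card_univ, Fintype.card_fin]
  calc _ ≤ ∏ i, ENNReal.ofReal ((K i * t ^ Module.finrank ℂ
          (Submodule.span ℂ (S i : Set (Fin nt → ℂ)))) ^ nr) := by
        refine Finset.prod_le_prod' fun i _ => ?_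
        rw [ENNReal.ofReal_pow (mul_nonneg (hK0 i) (pow_nonneg ht _))]
        exact pow_le_pow_left' (hK i t ht) nr
    _ = _ := by
        rw [← ENNReal.ofReal_prod_of_nonneg fun i _ =>
          pow_nonneg (mul_nonneg (hK0 i) (pow_nonneg ht _)) _]
        congr 1
        simp only [mul_pow, ← pow_mul, Finset.prod_mul_distrib]
        rw [Finset.prod_pow_eq_pow_sum, Finset.mul_sum]
        simp only [mul_comm]

/-- Vectors of `D` that the matrix `H` nearly annihilates. -/
def nearKernel (D : Finset (Fin nt → ℂ)) (t : ℝ) (H : Fin nr → Fin nt → ℂ) :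
    Finset (Fin nt → ℂ) := by
  classical exact D.filter fun d => normSq ((Matrix.of H).mulVec d) ≤ t

lemma mem_nearKernel {D : Finset (Fin nt → ℂ)} {t : ℝ} {H : Fin nr → Fin nt → ℂ}
    {d : Fin nt → ℂ} :
    d ∈ nearKernel D t H ↔ d ∈ D ∧ normSq ((Matrix.of H).mulVec d) ≤ t := by
  classical
  simp [nearKernel]

lemma channelLaw_nearKernel_le (D : Finset (Fin nt → ℂ)) (κ : ℕ) :
    ∃ K : ℝ, 0 ≤ K ∧ ∀ t : ℝ, 0 ≤ t → t ≤ 1 →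
      (channelLaw N nr nt).real {H | κ ≤ ∑ i, Module.finrank ℂ
        (Submodule.span ℂ (nearKernel D t (H i) : Set (Fin nt → ℂ)))} ≤ K * t ^ (nr * κ) := by
  classical
  choose K hK0 hK using fun S : Fin N → Finset (Fin nt → ℂ) =>
    channelLaw_small_le (nr := nr) S
  set I : Finset (Fin N → Finset (Fin nt → ℂ)) :=
    (Fintype.piFinset fun _ => D.powerset).filter fun S => κ ≤ ∑ i, Module.finrank ℂ
      (Submodule.span ℂ (S i : Set (Fin nt → ℂ))) with hI
  refine ⟨∑ S ∈ I, K S, Finset.sum_nonneg fun S _ => hK0 S, fun t ht ht1 => ?_⟩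
  rw [measureReal_def]
  refine ENNReal.toReal_le_of_le_ofReal (mul_nonneg (Finset.sum_nonneg fun S _ => hK0 S)
    (pow_nonneg ht _)) ?_
  have hsub : {H : Fin N → Fin nr → Fin nt → ℂ | κ ≤ ∑ i, Module.finrank ℂ
      (Submodule.span ℂ (nearKernel D t (H i) : Set (Fin nt → ℂ)))} ⊆
      ⋃ S ∈ I, {H | ∀ i, ∀ d ∈ S i, normSq ((Matrix.of (H i)).mulVec d) ≤ t} := by
    intro H hH
    refine Set.mem_biUnion (x := fun i => nearKernel D t (H i)) ?_ fun i d hd =>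
      (mem_nearKernel.1 hd).2
    refine Finset.mem_coe.2 (Finset.mem_filter.2 ⟨Fintype.mem_piFinset.2 fun i => ?_, hH⟩)
    exact Finset.mem_powerset.2 fun d hd => (mem_nearKernel.1 hd).1
  refine (measure_mono hsub).trans ((measure_biUnion_finset_le _ _).trans ?_)
  rw [Finset.sum_mul, ENNReal.ofReal_sum_of_nonneg fun S _ =>
    mul_nonneg (hK0 S) (pow_nonneg ht _)]
  refine Finset.sum_le_sum fun S hS => (hK S t ht).trans (ENNReal.ofReal_le_ofReal ?_)
  refine mul_le_mul_of_nonneg_left (pow_le_pow_of_le_one ht ht1 ?_) (hK0 S)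
  exact Nat.mul_le_mul_left _ (Finset.mem_filter.1 hS).2

/-- Rarely is any nonzero vector of `D` nearly annihilated by any of the matrices. -/
lemma channelLaw_exists_small_le (D : Finset (Fin nt → ℂ)) (hD : ∀ d ∈ D, d ≠ 0) :
    ∃ K : ℝ, 0 ≤ K ∧ ∀ t : ℝ, 0 ≤ t → t ≤ 1 →
      (channelLaw N nr nt).real
        {H | ∃ i, ∃ d ∈ D, normSq ((Matrix.of (H i)).mulVec d) ≤ t} ≤ K * t ^ nr := by
  obtain ⟨K, hK0, hK⟩ := channelLaw_nearKernel_le (N := N) (nr := nr) D 1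
  refine ⟨K, hK0, fun t ht ht1 => ?_⟩
  refine le_trans (measureReal_mono ?_) ((hK t ht ht1).trans_eq (by rw [mul_one]))
  rintro H ⟨i, d, hd, hdt⟩
  have hmem : d ∈ Submodule.span ℂ (nearKernel D t (H i) : Set (Fin nt → ℂ)) :=
    Submodule.subset_span (Finset.mem_coe.2 (mem_nearKernel.2 ⟨hd, hdt⟩))
  have h1 : 0 < Module.finrank ℂ
      (Submodule.span ℂ (nearKernel D t (H i) : Set (Fin nt → ℂ))) :=
    Module.finrank_pos_iff_exists_ne_zero.2 ⟨⟨d, hmem⟩, fun h => hD d hd (congrArg Subtype.val h)⟩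
  exact le_trans h1 (Finset.single_le_sum (f := fun i => Module.finrank ℂ
    (Submodule.span ℂ (nearKernel D t (H i) : Set (Fin nt → ℂ)))) (fun _ _ => Nat.zero_le _)
      (Finset.mem_univ i))

lemma channelLaw_all_small_le (N nr nt : ℕ) {t : ℝ} (ht : 0 ≤ t) :
    (channelLaw N nr nt).real {H | ∀ i r j, ‖H i r j‖ ^ 2 ≤ t} ≤ t ^ (nt * nr * N) := by
  rw [measureReal_def]
  refine ENNReal.toReal_le_of_le_ofReal (pow_nonneg ht _) ?_
  have hsub : {H : Fin N → Fin nr → Fin nt → ℂ | ∀ i r j, ‖H i r j‖ ^ 2 ≤ t} ⊆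
      {H | ∀ i r j, H i r j ∈ Metric.closedBall 0 √t} := fun H hH i r j => by
    rw [mem_closedBall_zero_iff]
    exact Real.le_sqrt_of_sq_le (hH i r j)
  refine (measure_mono hsub).trans ?_
  rw [channelLaw_pi fun _ _ _ => Metric.closedBall 0 √t]
  simp only [Finset.prod_const, Finset.card_univ, Fintype.card_fin, ← pow_mul]
  rw [ENNReal.ofReal_pow ht]
  refine pow_le_pow_left' ?_ _
  simpa [Real.sq_sqrt ht] using stdComplexGaussian_closedBall_le 0 (Real.sqrt_nonneg t)

/-- The columns selected by `T` are all small with probability of order `t ^ (nr * |T|)`. -/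
lemma le_channelLaw_columns_small (nr : ℕ) (T : Finset (Fin N × Fin nt)) {t : ℝ} (ht : 0 ≤ t)
    (ht1 : t ≤ 1) :
    (Real.exp (-1) * t) ^ (nr * T.card) ≤ (channelLaw N nr nt).real
      {H | ∀ i r j, (i, j) ∈ T → ‖H i r j‖ ^ 2 ≤ t} := by
  classical
  rw [measureReal_def, ← ENNReal.ofReal_le_iff_le_toReal (measure_ne_top _ _)]
  have hsub : {H : Fin N → Fin nr → Fin nt → ℂ | ∀ i r j, H i r j ∈
      if (i, j) ∈ T then Metric.closedBall 0 √t else Set.univ} ⊆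
      {H | ∀ i r j, (i, j) ∈ T → ‖H i r j‖ ^ 2 ≤ t} := fun H hH i r j hT => by
    have h := hH i r j
    rw [if_pos hT, mem_closedBall_zero_iff] at h
    exact (Real.le_sqrt (norm_nonneg _) ht).1 h
  refine le_trans ?_ (measure_mono hsub)
  rw [channelLaw_pi fun i _ j => if (i, j) ∈ T then Metric.closedBall 0 √t else Set.univ]
  have hterm : ∀ i j, stdComplexGaussian (if (i, j) ∈ T then Metric.closedBall 0 √t else Set.univ)
      = if (i, j) ∈ T then stdComplexGaussian (Metric.closedBall 0 √t) else 1 := fun i j => by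
    split_ifs <;> simp
  simp only [hterm, Finset.prod_const, Finset.card_univ, Fintype.card_fin]
  rw [Finset.prod_pow, ← Fintype.prod_prod_type' (f := fun i j =>
    if (i, j) ∈ T then stdComplexGaussian (Metric.closedBall 0 √t) else 1),
    Finset.prod_ite_mem, Finset.univ_inter, Finset.prod_const, ← pow_mul, mul_comm T.card,
    ENNReal.ofReal_pow (by positivity)]
  refine pow_le_pow_left' ?_ _
  simpa [Real.sq_sqrt ht] using
    le_stdComplexGaussian_closedBall (Real.sqrt_nonneg t) (Real.sqrt_le_one.2 ht1)

end

section

/-! ### The outage event and the SNR exponent -/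

variable {N nr nt : ℕ}

lemma hasSNRExponent_of_bounds {P : ℝ → ℝ} {d : ℝ}
    (hlow : ∃ c > 0, ∀ᶠ s in atTop, c * s ^ (-d) ≤ P s)
    (hup : ∀ ε > 0, ∃ C > 0, ∀ᶠ s in atTop, P s ≤ C * s ^ (-(d - ε))) :
    HasSNRExponent P d := by
  obtain ⟨c, hc, hlow⟩ := hlow
  have hdiv : ∀ a : ℝ, Tendsto (fun s : ℝ => a / Real.log s) atTop (𝓝 0) := fun a =>
    Real.tendsto_log_atTop.const_div_atTop a
  rw [HasSNRExponent, tendsto_order]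
  constructor
  · intro a ha
    obtain ⟨C, hC, hup⟩ := hup ((d - a) / 2) (by linarith)
    filter_upwards [hlow, hup, eventually_gt_atTop 1,
      (hdiv (Real.log C)).eventually_lt_const (show 0 < (d - a) / 2 by linarith)]
      with s h1 h2 hs h3
    have hL : 0 < Real.log s := Real.log_pos hs
    have hs0 : 0 < s := by linarith
    have hP : 0 < P s := lt_of_lt_of_le (by positivity) h1
    have h4 := Real.log_le_log hP h2
    rw [Real.log_mul hC.ne' (by positivity), Real.log_rpow hs0] at h4
    rw [div_lt_iff₀ hL] at h3
    rw [lt_div_iff₀ hL]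
    linarith
  · intro a ha
    filter_upwards [hlow, eventually_gt_atTop 1,
      (hdiv (-Real.log c)).eventually_lt_const (show 0 < a - d by linarith)] with s h1 hs h3
    have hL : 0 < Real.log s := Real.log_pos hs
    have hs0 : 0 < s := by linarith
    have h4 := Real.log_le_log (by positivity) h1
    rw [Real.log_mul hc.ne' (by positivity), Real.log_rpow hs0] at h4
    rw [div_lt_iff₀ hL] at h3
    rw [div_lt_iff₀ hL]
    linarith

lemma txDistortion_gt_iff (hN : 0 < N) (Q : Measure (Fin nt → ℂ)) {b Dbar : ℝ} (hb : 0 < b)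
    (hD0 : 0 < Dbar) (snr : ℝ) (H : Fin N → Fin nr → Fin nt → ℂ) :
    txDistortion Q b snr H > Dbar ↔ ∑ i, blockMutualInfo Q snr (H i) * Real.log 2 <
      N * (rateDistortion Dbar / b * Real.log 2) := by
  have hN' : (0 : ℝ) < N := by exact_mod_cast hN
  have h2 : 0 < Real.log 2 := Real.log_pos one_lt_two
  rw [gt_iff_lt, txDistortion, distortionRate, ← Real.logb_lt_iff_lt_rpow one_lt_two hD0,
    rateDistortion, mutualInfo, ← Finset.sum_mul]
  set S := ∑ i, blockMutualInfo Q snr (H i)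
  have e1 : N * (-Real.logb 2 Dbar / 2 / b * Real.log 2) - S * Real.log 2 =
      (-2 * (b * (1 / N * S)) - Real.logb 2 Dbar) * (N * Real.log 2 / (2 * b)) := by
    field_simp
    ring
  have hpos : 0 < N * Real.log 2 / (2 * b) := by positivity
  constructor
  · intro h
    nlinarith [mul_pos (sub_pos.2 h) hpos]
  · intro h
    have h3 := sub_pos.2 h
    rw [e1] at h3
    linarith [pos_of_mul_pos_left h3 hpos.le]

lemma rateDistortion_pos {D : ℝ} (hD0 : 0 < D) (hD1 : D < 1) : 0 < rateDistortion D := by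
  have := Real.logb_neg one_lt_two hD0 hD1
  unfold rateDistortion
  linarith

/-- If outage occurs as soon as the columns in `T` have squared entries at most `δ / snr`, then
the SNR exponent is at most `nr * |T|`. -/
lemma outage_lower_bound (T : Finset (Fin N × Fin nt)) (Q : Measure (Fin nt → ℂ))
    {b Dbar δ : ℝ} (hδ0 : 0 < δ) (hδ1 : δ ≤ 1)
    (h : ∀ snr, 0 < snr → ∀ H : Fin N → Fin nr → Fin nt → ℂ,
      (∀ i r j, (i, j) ∈ T → ‖H i r j‖ ^ 2 ≤ δ / snr) → txDistortion Q b snr H > Dbar) :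
    ∃ c > 0, ∀ᶠ s in atTop,
      c * s ^ (-((nr * T.card : ℕ) : ℝ)) ≤ txOutageProb N nr Q b Dbar s := by
  refine ⟨(Real.exp (-1) * δ) ^ (nr * T.card), by positivity, ?_⟩
  filter_upwards [eventually_ge_atTop 1] with s hs
  have hs0 : 0 < s := by linarith
  have h1 := le_channelLaw_columns_small nr T (t := δ / s) (by positivity)
    ((div_le_one hs0).2 (hδ1.trans hs))
  refine le_trans (le_of_eq ?_) (h1.trans (measureReal_mono fun H hH => h s hs0 H hH))
  rw [Real.rpow_neg hs0.le, Real.rpow_natCast, ← mul_div_assoc, div_pow]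
  rfl

lemma exists_delta {B c : ℝ} (hB : 0 ≤ B) (hc : 0 < c) : ∃ δ : ℝ, 0 < δ ∧ δ ≤ 1 ∧ δ * B < c := by
  refine ⟨min 1 (c / (B + 1)), by positivity, min_le_left _ _, ?_⟩
  calc min 1 (c / (B + 1)) * B ≤ c / (B + 1) * B :=
        mul_le_mul_of_nonneg_right (min_le_right _ _) hB
    _ < c := by
        rw [div_mul_eq_mul_div, div_lt_iff₀ (by linarith)]
        nlinarith

/-! ### Exponent for Gaussian inputs -/

theorem hasSNRExponent_gaussianInput (hN : 0 < N) (hnt : 0 < nt) {b Dbar : ℝ} (hb : 0 < b)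
    (hD0 : 0 < Dbar) (hD1 : Dbar < 1) :
    HasSNRExponent (txOutageProb N nr (gaussianInput nt) b Dbar) ((nt : ℝ) * nr * N) := by
  have hN' : (0 : ℝ) < N := by exact_mod_cast hN
  have hnt' : (0 : ℝ) < nt := by exact_mod_cast hnt
  have h2 : 0 < Real.log 2 := Real.log_pos one_lt_two
  have hQ := integrable_normSq_gaussianInput nt
  set R := rateDistortion Dbar / b * Real.log 2 with hR
  have hR0 : 0 < R := mul_pos (div_pos (rateDistortion_pos hD0 hD1) hb) h2
  refine hasSNRExponent_of_bounds ?_ fun ε hε => ?_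
  · set B : ℝ := nr * ∑ j, 4 * ∫ x, ‖x j‖ ^ 2 ∂(gaussianInput nt) with hB
    have hB0 : 0 ≤ B := mul_nonneg (Nat.cast_nonneg _) (Finset.sum_nonneg fun j _ =>
      mul_nonneg (by norm_num) (integral_nonneg fun x => sq_nonneg _))
    obtain ⟨δ, hδ0, hδ1, hδ⟩ := exists_delta hB0 hR0
    have h := outage_lower_bound (nr := nr) (Finset.univ : Finset (Fin N × Fin nt))
      (gaussianInput nt) (b := b) (Dbar := Dbar) hδ0 hδ1 ?_
    · have e : ((nr * (Finset.univ : Finset (Fin N × Fin nt)).card : ℕ) : ℝ) =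
          (nt : ℝ) * nr * N := by
        simp only [Finset.card_univ, Fintype.card_prod, Fintype.card_fin]
        push_cast
        ring
      rwa [e] at h
    · intro s hs H hH
      rw [txDistortion_gt_iff hN _ hb hD0]
      have hI : ∀ i, blockMutualInfo (gaussianInput nt) s (H i) * Real.log 2 ≤ δ * B := fun i => by
        have := blockMutualInfo_le_of_norm_le hs.le hnt (H i) hQ
          fun r j => hH i r j (Finset.mem_univ _)
        rwa [mul_div_cancel₀ _ hs.ne'] at this
      calc _ ≤ ∑ _i : Fin N, δ * B := Finset.sum_le_sum fun i _ => hI i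
        _ = N * (δ * B) := by simp
        _ < N * R := mul_lt_mul_of_pos_left hδ hN'
  · set C := 4 * nt * Real.exp (N * R) with hC
    refine ⟨C ^ (nt * nr * N), by positivity, ?_⟩
    filter_upwards [eventually_ge_atTop 1] with s hs
    have hs0 : 0 < s := by linarith
    have hsub : {H : Fin N → Fin nr → Fin nt → ℂ | txDistortion (gaussianInput nt) b s H > Dbar} ⊆
        {H | ∀ i r j, ‖H i r j‖ ^ 2 ≤ C / s} := by
      intro H hH i r j
      rw [Set.mem_ofPred_eq, txDistortion_gt_iff hN _ hb hD0] at hH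
      by_cases h0 : H i r j = 0
      · rw [h0]
        simp only [norm_zero, ne_eq, OfNat.ofNat_ne_zero, not_false_eq_true, zero_pow]
        positivity
      have hpos : 0 < ‖H i r j‖ := norm_pos_iff.2 h0
      have h3 : blockMutualInfo (gaussianInput nt) s (H i) * Real.log 2 ≤
          ∑ i, blockMutualInfo (gaussianInput nt) s (H i) * Real.log 2 :=
        Finset.single_le_sum (f := fun i => blockMutualInfo (gaussianInput nt) s (H i) *
          Real.log 2) (fun i _ => mul_nonneg (blockMutualInfo_nonneg hs0.le hnt (H i) hQ) h2.le)
          (Finset.mem_univ i)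
      have h4 := neg_log_avgBhattacharyya_le_blockMutualInfo hs0.le hnt (H i) hQ
      have h5 := avgBhattacharyya_gaussianInput_le hs0 hnt (H i) r j h0
      have hG0 : 0 < avgBhattacharyya (gaussianInput nt) (fadedInput s (H i)) :=
        avgBhattacharyya_pos (measurable_fadedInput _ _)
      have h6 : Real.exp (-(N * R)) ≤
          avgBhattacharyya (gaussianInput nt) (fadedInput s (H i)) := by
        rw [← Real.le_log_iff_exp_le hG0]
        linarith
      have h7 := h6.trans h5
      rw [Real.exp_neg, inv_eq_one_div, div_le_div_iff₀ (Real.exp_pos _) (by positivity)] at h7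
      rw [le_div_iff₀ hs0, hC]
      linarith
    refine (measureReal_mono hsub).trans ((channelLaw_all_small_le N nr nt (by positivity)).trans ?_)
    rw [div_pow, div_eq_mul_inv, ← Real.rpow_natCast s, ← Real.rpow_neg hs0.le]
    refine mul_le_mul_of_nonneg_left (Real.rpow_le_rpow_of_exponent_le hs ?_) (by positivity)
    push_cast
    linarith

/-! ### Exponent for discrete inputs -/

/-- The nonzero differences of codebook vectors. -/
def codebookDifferences (nt : ℕ) (𝒳 : Finset ℂ) : Finset (Fin nt → ℂ) := by
  classical exact
    ((codebook nt 𝒳 ×ˢ codebook nt 𝒳).image fun p => p.1 - p.2).filter fun d => d ≠ 0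

lemma mem_codebookDifferences {𝒳 : Finset ℂ} {d : Fin nt → ℂ} :
    d ∈ codebookDifferences nt 𝒳 ↔
      (∃ x ∈ codebook nt 𝒳, ∃ x' ∈ codebook nt 𝒳, x - x' = d) ∧ d ≠ 0 := by
  classical
  simp only [codebookDifferences, Finset.mem_filter, Finset.mem_image, Finset.mem_product,
    Prod.exists]
  constructor
  · rintro ⟨⟨x, x', ⟨hx, hx'⟩, h⟩, h0⟩
    exact ⟨⟨x, hx, x', hx', h⟩, h0⟩
  · rintro ⟨⟨x, hx, x', hx', h⟩, h0⟩
    exact ⟨⟨x, x', ⟨hx, hx'⟩, h⟩, h0⟩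

/-- Dimension of the span of the codebook differences that `H` nearly annihilates. -/
def lostDimension (𝒳 : Finset ℂ) (t : ℝ) (H : Fin nr → Fin nt → ℂ) : ℕ :=
  Module.finrank ℂ
    (Submodule.span ℂ (nearKernel (codebookDifferences nt 𝒳) t H : Set (Fin nt → ℂ)))

/-- Cutoff rate of a block in terms of the differences that are not resolved at level `t`. -/
lemma log_avgBhattacharyya_le_lostDimension {𝒳 : Finset ℂ} (h𝒳 : 𝒳.Nonempty) {s t τ θ : ℝ}
    (hs : 0 < s) (hθ0 : 0 ≤ θ) (hθ : Real.exp (-(s / nt * τ) / 4) ≤ 1 - θ)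
    (H : Fin nr → Fin nt → ℂ)
    (hτ : ∀ d ∈ codebookDifferences nt 𝒳, τ ≤ normSq ((Matrix.of H).mulVec d)) :
    Real.log (avgBhattacharyya (discreteInput nt 𝒳) (fadedInput s H)) ≤
      ((lostDimension 𝒳 t H : ℝ) - nt) * Real.log 𝒳.card +
        ((𝒳.card : ℝ) ^ nt * Real.exp (-(s / nt * t) / 4) -
          (if lostDimension 𝒳 t H = 0 then 0 else θ) / (𝒳.card : ℝ) ^ (2 * nt)) := by
  set V := Submodule.span ℂ (nearKernel (codebookDifferences nt 𝒳) t H : Set (Fin nt → ℂ))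
    with hVdef
  have hV : ∀ x ∈ codebook nt 𝒳, ∀ x' ∈ codebook nt 𝒳, x - x' ∉ V →
      Real.exp (-normSq (fadedInput s H x - fadedInput s H x') / 4) ≤
        Real.exp (-(s / nt * t) / 4) := by
    intro x hx x' hx' hxV
    rw [Real.exp_le_exp, normSq_fadedInput_sub hs.le]
    have h0 : x - x' ≠ 0 := fun h => hxV (h ▸ V.zero_mem)
    have hD : x - x' ∈ codebookDifferences nt 𝒳 :=
      mem_codebookDifferences.2 ⟨⟨x, hx, x', hx', rfl⟩, h0⟩
    have ht : t ≤ normSq ((Matrix.of H).mulVec (x - x')) := by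
      by_contra hlt
      exact hxV (Submodule.subset_span
        (Finset.mem_coe.2 (mem_nearKernel.2 ⟨hD, (not_le.1 hlt).le⟩)))
    have := mul_le_mul_of_nonneg_left ht (show 0 ≤ s / nt by positivity)
    linarith
  by_cases hk : lostDimension 𝒳 t H = 0
  · rw [if_pos hk]
    obtain ⟨x, hx⟩ := codebook_nonempty (nt := nt) h𝒳
    exact log_avgBhattacharyya_discreteInput_le h𝒳 H V (Real.exp_pos _).le le_rfl hV hx hx
      (by simp) (by simp [normSq])
  · rw [if_neg hk]
    have hne : (nearKernel (codebookDifferences nt 𝒳) t H).Nonempty := by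
      by_contra hempty
      rw [Finset.not_nonempty_iff_eq_empty] at hempty
      exact hk (by simp [lostDimension, hempty])
    obtain ⟨d, hd⟩ := hne
    have hdD := (mem_nearKernel.1 hd).1
    obtain ⟨⟨x, hx, x', hx', rfl⟩, -⟩ := mem_codebookDifferences.1 hdD
    refine log_avgBhattacharyya_discreteInput_le h𝒳 H V (Real.exp_pos _).le hθ0 hV hx hx'
      (Submodule.subset_span (Finset.mem_coe.2 hd)) (le_trans ?_ hθ)
    rw [Real.exp_le_exp, normSq_fadedInput_sub hs.le]
    have := mul_le_mul_of_nonneg_left (hτ _ hdD) (show 0 ≤ s / nt by positivity)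
    linarith

/-- In outage, more than `A` dimensions are lost, where `A` is the number of symbols that the
blocks may lose before the rate is exceeded. When exactly `A` dimensions are lost, the residual
information `θ` in the lost ones outweighs the loss in the others. -/
lemma lt_sum_lostDimension_of_outage {𝒳 : Finset ℂ} (h𝒳 : 𝒳.Nonempty) {s t τ θ A : ℝ}
    (hs : 0 < s) (hnt : 0 < nt) (hθ0 : 0 ≤ θ) (hθ : Real.exp (-(s / nt * τ) / 4) ≤ 1 - θ)
    (hM : 0 ≤ Real.log 𝒳.card)
    (h1 : N * ((𝒳.card : ℝ) ^ nt * Real.exp (-(s / nt * t) / 4)) ≤ θ / (𝒳.card : ℝ) ^ (2 * nt))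
    (h2 : N * ((𝒳.card : ℝ) ^ nt * Real.exp (-(s / nt * t) / 4)) ≤ A * Real.log 𝒳.card)
    (H : Fin N → Fin nr → Fin nt → ℂ)
    (hτ : ∀ i, ∀ d ∈ codebookDifferences nt 𝒳, τ ≤ normSq ((Matrix.of (H i)).mulVec d))
    (hout : ∑ i, blockMutualInfo (discreteInput nt 𝒳) s (H i) * Real.log 2 <
      (N * nt - A) * Real.log 𝒳.card) :
    A < ∑ i, (lostDimension 𝒳 t (H i) : ℝ) := by
  have := isProbabilityMeasure_discreteInput (nt := nt) h𝒳
  have hI : ∀ i, -(((lostDimension 𝒳 t (H i) : ℝ) - nt) * Real.log 𝒳.card +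
        ((𝒳.card : ℝ) ^ nt * Real.exp (-(s / nt * t) / 4) -
          (if lostDimension 𝒳 t (H i) = 0 then 0 else θ) / (𝒳.card : ℝ) ^ (2 * nt))) ≤
      blockMutualInfo (discreteInput nt 𝒳) s (H i) * Real.log 2 := fun i =>
    (neg_le_neg (log_avgBhattacharyya_le_lostDimension h𝒳 hs hθ0 hθ (H i) (hτ i))).trans
      (neg_log_avgBhattacharyya_le_blockMutualInfo hs.le hnt (H i)
        fun j => integrable_discreteInput _)
  have hsum := (Finset.sum_le_sum fun i (_ : i ∈ Finset.univ) => hI i).trans_lt hout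
  rw [Finset.sum_neg_distrib, Finset.sum_add_distrib, Finset.sum_sub_distrib, ← Finset.sum_mul,
    Finset.sum_sub_distrib, ← Finset.sum_div] at hsum
  simp only [Finset.sum_const, Finset.card_univ, Fintype.card_fin, nsmul_eq_mul] at hsum
  by_contra hle
  rw [not_lt] at hle
  by_cases hall : ∀ i, lostDimension 𝒳 t (H i) = 0
  · simp only [hall, Nat.cast_zero, if_true, Finset.sum_const_zero, zero_div] at hsum
    linarith
  · push Not at hall
    obtain ⟨i₀, hi₀⟩ := hall
    have hθle : θ ≤ ∑ i, if lostDimension 𝒳 t (H i) = 0 then 0 else θ := by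
      refine le_trans (le_of_eq ?_) (Finset.single_le_sum (f := fun i =>
        if lostDimension 𝒳 t (H i) = 0 then 0 else θ) (fun i _ => ?_) (Finset.mem_univ i₀))
      · simp [hi₀]
      · split_ifs
        exacts [le_rfl, hθ0]
    have h3 : θ / (𝒳.card : ℝ) ^ (2 * nt) ≤
        (∑ i, if lostDimension 𝒳 t (H i) = 0 then 0 else θ) / (𝒳.card : ℝ) ^ (2 * nt) := by
      gcongr
    have h4 := mul_le_mul_of_nonneg_right hle hM
    linarith

lemma eventually_exp_neg_rpow_le {a ε p c K : ℝ} (ha : 0 < a) (hε : 0 < ε) (hc : 0 < c) :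
    ∀ᶠ s : ℝ in atTop, K * Real.exp (-a * s ^ ε) ≤ c * s ^ (-p) := by
  have h1 : Tendsto (fun s : ℝ => K * ((s ^ ε) ^ (p / ε) * Real.exp (-a * s ^ ε))) atTop
      (𝓝 (K * 0)) :=
    ((tendsto_rpow_mul_exp_neg_mul_atTop_nhds_zero (p / ε) a ha).comp
      (tendsto_rpow_atTop hε)).const_mul K
  rw [mul_zero] at h1
  filter_upwards [h1.eventually_lt_const hc, eventually_gt_atTop 0] with s hs hs0
  rw [← Real.rpow_mul hs0.le, mul_div_cancel₀ _ hε.ne'] at hs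
  rw [Real.rpow_neg hs0.le, ← div_eq_mul_inv, le_div_iff₀ (by positivity)]
  linarith

lemma sum_card_filter_mem (T : Finset (Fin N × Fin nt)) [DecidableEq (Fin N × Fin nt)] :
    ∑ i, (Finset.univ.filter fun j => (i, j) ∈ T).card = T.card := by
  simp only [Finset.card_filter]
  rw [← Fintype.sum_prod_type' (f := fun i j => if (i, j) ∈ T then 1 else 0)]
  simp

lemma discrete_outage_lower_bound (hN : 0 < N) (hnt : 0 < nt) {𝒳 : Finset ℂ}
    (h𝒳 : 2 ≤ 𝒳.card) {b Dbar A : ℝ} (hb : 0 < b) (hD0 : 0 < Dbar)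
    (hA : N * (rateDistortion Dbar / b * Real.log 2) = (N * nt - A) * Real.log 𝒳.card)
    {κ : ℕ} (hκ : κ ≤ N * nt) (hAκ : A < κ) :
    ∃ c > 0, ∀ᶠ s in atTop,
      c * s ^ (-((nr * κ : ℕ) : ℝ)) ≤ txOutageProb N nr (discreteInput nt 𝒳) b Dbar s := by
  classical
  have hne : 𝒳.Nonempty := Finset.card_pos.1 (by omega)
  have hlog : 0 < Real.log 𝒳.card := Real.log_pos (by exact_mod_cast h𝒳)
  obtain ⟨T, -, hT⟩ := Finset.exists_subset_card_eq
    (s := (Finset.univ : Finset (Fin N × Fin nt))) (n := κ) (by simpa using hκ)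
  obtain ⟨Δ, hΔ⟩ := ((𝒳 ×ˢ 𝒳).image fun p => ‖p.1 - p.2‖ ^ 2).bddAbove
  have hΔ' : ∀ u ∈ 𝒳, ∀ v ∈ 𝒳, ‖u - v‖ ^ 2 ≤ Δ := fun u hu v hv =>
    hΔ (Finset.mem_coe.2 (Finset.mem_image.2 ⟨(u, v), Finset.mem_product.2 ⟨hu, hv⟩, rfl⟩))
  have hΔ0 : 0 ≤ Δ := by
    obtain ⟨z, hz⟩ := hne
    simpa using hΔ' z hz z hz
  obtain ⟨δ, hδ0, hδ1, hδ⟩ := exists_delta (B := N * (nr * (nt * Δ)))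
    (c := (κ - A) * Real.log 𝒳.card) (by positivity) (mul_pos (sub_pos.2 hAκ) hlog)
  rw [← hT]
  refine outage_lower_bound T _ hδ0 hδ1 fun s hs H hH => ?_
  rw [txDistortion_gt_iff hN _ hb hD0, hA]
  have hI : ∀ i, blockMutualInfo (discreteInput nt 𝒳) s (H i) * Real.log 2 ≤
      ((nt : ℝ) - (Finset.univ.filter fun j => (i, j) ∈ T).card) * Real.log 𝒳.card +
        δ * (nr * (nt * Δ)) := fun i => by
    have h := blockMutualInfo_discreteInput_le hs.le hnt hne hΔ' (H i)
      (Finset.univ.filter fun j => (i, j) ∈ T) (η := δ / s)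
      (fun r j hj => hH i r j (Finset.mem_filter.1 hj).2) (by positivity)
    have e : s * (nr * (nt * (δ / s * Δ))) = δ * (nr * (nt * Δ)) := by field_simp
    rwa [e] at h
  have hc : ∑ i, ((Finset.univ.filter fun j => (i, j) ∈ T).card : ℝ) = κ := by
    rw [← Nat.cast_sum, sum_card_filter_mem, hT]
  refine (Finset.sum_le_sum fun i _ => hI i).trans_lt ?_
  rw [Finset.sum_add_distrib, ← Finset.sum_mul, Finset.sum_sub_distrib, hc]
  simp only [Finset.sum_const, Finset.card_univ, Fintype.card_fin, nsmul_eq_mul]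
  linarith

lemma discrete_outage_upper_bound (hN : 0 < N) (hnt : 0 < nt) {𝒳 : Finset ℂ}
    (h𝒳 : 2 ≤ 𝒳.card) {b Dbar A : ℝ} (hb : 0 < b) (hD0 : 0 < Dbar) (hA0 : 0 < A)
    (hA : N * (rateDistortion Dbar / b * Real.log 2) = (N * nt - A) * Real.log 𝒳.card)
    {κ : ℕ} (hκ : 0 < κ) (hκA : (κ : ℝ) ≤ A + 1) {ε : ℝ} (hε : 0 < ε) :
    ∃ C > 0, ∀ᶠ s in atTop, txOutageProb N nr (discreteInput nt 𝒳) b Dbar s ≤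
      C * s ^ (-(((nr * κ : ℕ) : ℝ) - ε)) := by
  have hne : 𝒳.Nonempty := Finset.card_pos.1 (by omega)
  have hlog : 0 < Real.log 𝒳.card := Real.log_pos (by exact_mod_cast h𝒳)
  have hnt' : (0 : ℝ) < nt := by exact_mod_cast hnt
  have hM : (0 : ℝ) < 𝒳.card := by exact_mod_cast hne.card_pos
  set d : ℝ := ((nr * κ : ℕ) : ℝ) with hd
  have hd0 : 0 ≤ d := Nat.cast_nonneg _
  -- differences are unresolved if their squared length is at most `s ^ (-(1 - ε'))`
  obtain ⟨ε', hε'0, hε'1, hε'⟩ := exists_delta hd0 hε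
  obtain ⟨K₁, hK₁0, hK₁⟩ := channelLaw_nearKernel_le (N := N) (nr := nr)
    (codebookDifferences nt 𝒳) κ
  obtain ⟨K₂, hK₂0, hK₂⟩ := channelLaw_exists_small_le (N := N) (nr := nr)
    (codebookDifferences nt 𝒳) fun d hd => (mem_codebookDifferences.1 hd).2
  refine ⟨K₁ + K₂ + 1, by positivity, ?_⟩
  have hev1 := eventually_exp_neg_rpow_le (a := 1 / (4 * nt)) (ε := ε') (p := κ - 1)
    (c := 1 / (8 * nt) / (𝒳.card : ℝ) ^ (2 * nt)) (K := N * (𝒳.card : ℝ) ^ nt) (by positivity)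
    hε'0 (by positivity)
  have hev2 := eventually_exp_neg_rpow_le (a := 1 / (4 * nt)) (ε := ε') (p := 0)
    (c := A * Real.log 𝒳.card) (K := N * (𝒳.card : ℝ) ^ nt) (by positivity) hε'0 (by positivity)
  filter_upwards [hev1, hev2, eventually_ge_atTop 1] with s h1 h2 hs
  have hs0 : 0 < s := by linarith
  set t : ℝ := s ^ (-(1 - ε')) with ht
  set τ : ℝ := s ^ (-(κ : ℝ)) with hτ
  have ht0 : 0 ≤ t := by positivity
  have ht1 : t ≤ 1 := Real.rpow_le_one_of_one_le_of_nonpos hs (by linarith)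
  have hτ0 : 0 ≤ τ := by positivity
  have hτ1 : τ ≤ 1 := Real.rpow_le_one_of_one_le_of_nonpos hs (by simp)
  have hst : s * t = s ^ ε' := by
    rw [ht]
    nth_rewrite 1 [← Real.rpow_one s]
    rw [← Real.rpow_add hs0]
    ring_nf
  have hsτ : s * τ = s ^ (-((κ : ℝ) - 1)) := by
    rw [hτ]
    nth_rewrite 1 [← Real.rpow_one s]
    rw [← Real.rpow_add hs0]
    ring_nf
  have hκ1 : (1 : ℝ) ≤ κ := by exact_mod_cast hκ
  have hsτ1 : s * τ ≤ 1 := by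
    rw [hsτ]
    exact Real.rpow_le_one_of_one_le_of_nonpos hs (by linarith)
  set θ : ℝ := s * τ / (8 * nt) with hθ
  have hθ0 : 0 ≤ θ := by positivity
  have hθe : Real.exp (-(s / nt * τ) / 4) ≤ 1 - θ := by
    have hnt1 : (1 : ℝ) ≤ nt := by exact_mod_cast hnt
    have hθ8 : θ ≤ 1 / 8 := by
      rw [hθ, div_le_iff₀ (by positivity)]
      linarith
    have e : -(s / nt * τ) / 4 = -(2 * θ) := by
      rw [hθ]
      field_simp
      ring
    rw [e, Real.exp_neg, inv_le_iff_one_le_mul₀ (Real.exp_pos _)]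
    nlinarith [Real.add_one_le_exp (2 * θ)]
  have hexp : -(s / nt * t) / 4 = -(1 / (4 * nt)) * s ^ ε' := by
    rw [← hst]
    field_simp
  have hsub : {H : Fin N → Fin nr → Fin nt → ℂ |
      txDistortion (discreteInput nt 𝒳) b s H > Dbar} ⊆
      {H | κ ≤ ∑ i, Module.finrank ℂ (Submodule.span ℂ
        (nearKernel (codebookDifferences nt 𝒳) t (H i) : Set (Fin nt → ℂ)))} ∪
      {H | ∃ i, ∃ d ∈ codebookDifferences nt 𝒳, normSq ((Matrix.of (H i)).mulVec d) ≤ τ} := by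
    intro H hH
    rw [Set.mem_ofPred_eq, txDistortion_gt_iff hN _ hb hD0, hA] at hH
    by_cases hbad : ∃ i, ∃ d ∈ codebookDifferences nt 𝒳,
        normSq ((Matrix.of (H i)).mulVec d) ≤ τ
    · exact Or.inr hbad
    · left
      push Not at hbad
      have h := lt_sum_lostDimension_of_outage (t := t) (A := A) hne hs0 hnt hθ0 hθe hlog.le
        (by rw [hexp, ← mul_assoc]
            refine h1.trans (le_of_eq ?_)
            rw [hθ, hsτ]
            ring)
        (by rw [hexp, ← mul_assoc]
            simpa using h2)
        H (fun i d hd => (hbad i d hd).le) hH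
      have h3 : (κ : ℝ) < ∑ i, (lostDimension 𝒳 t (H i) : ℝ) + 1 := by linarith
      have h4 : κ < ∑ i, lostDimension 𝒳 t (H i) + 1 := by exact_mod_cast h3
      exact Nat.lt_succ_iff.1 h4
  calc txOutageProb N nr (discreteInput nt 𝒳) b Dbar s
      ≤ K₁ * t ^ (nr * κ) + K₂ * τ ^ nr :=
        (measureReal_mono hsub).trans ((measureReal_union_le _ _).trans
          (add_le_add (hK₁ t ht0 ht1) (hK₂ τ hτ0 hτ1)))
    _ ≤ K₁ * s ^ (-(d - ε)) + K₂ * s ^ (-(d - ε)) := by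
        have e1 : t ^ (nr * κ) ≤ s ^ (-(d - ε)) := by
          rw [ht, ← Real.rpow_natCast, ← Real.rpow_mul hs0.le]
          refine Real.rpow_le_rpow_of_exponent_le hs ?_
          rw [← hd]
          linarith
        have e2 : τ ^ nr ≤ s ^ (-(d - ε)) := by
          rw [hτ, ← Real.rpow_natCast, ← Real.rpow_mul hs0.le]
          refine Real.rpow_le_rpow_of_exponent_le hs ?_
          rw [hd]
          push_cast
          linarith
        gcongr
    _ ≤ (K₁ + K₂ + 1) * s ^ (-(d - ε)) := by
        have : 0 < s ^ (-(d - ε)) := by positivity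
        linarith

theorem hasSNRExponent_discreteInput (hN : 0 < N) (hnt : 0 < nt) {b Dbar : ℝ} (hb : 0 < b)
    (hD0 : 0 < Dbar) (hD1 : Dbar < 1) {𝒳 : Finset ℂ} {m : ℝ} (h𝒳 : 2 ≤ 𝒳.card)
    (hm : m = Real.logb 2 𝒳.card) (hrate : rateDistortion Dbar / b < nt * m) :
    HasSNRExponent (txOutageProb N nr (discreteInput nt 𝒳) b Dbar)
      ((nr : ℝ) * (1 + (⌊(N : ℝ) * (nt - rateDistortion Dbar / (b * m))⌋ : ℝ))) := by
  have hN' : (0 : ℝ) < N := by exact_mod_cast hN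
  have h2 : 0 < Real.log 2 := Real.log_pos one_lt_two
  have hlog : 0 < Real.log 𝒳.card := Real.log_pos (by exact_mod_cast h𝒳)
  have hR0 := rateDistortion_pos hD0 hD1
  have hm0 : 0 < m := by rw [hm]; exact div_pos hlog h2
  have hlogm : Real.log 𝒳.card = m * Real.log 2 := by
    rw [hm, Real.logb, div_mul_cancel₀ _ h2.ne']
  set A : ℝ := (N : ℝ) * (nt - rateDistortion Dbar / (b * m)) with hAdef
  have hA0 : 0 < A := by
    refine mul_pos hN' (sub_pos.2 ?_)
    rw [div_lt_iff₀ (by positivity)]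
    rw [div_lt_iff₀ hb] at hrate
    linarith
  have hAlt : A < N * nt := by
    have : 0 < rateDistortion Dbar / (b * m) := by positivity
    rw [hAdef]
    exact mul_lt_mul_of_pos_left (by linarith) hN'
  have hA : N * (rateDistortion Dbar / b * Real.log 2) = (N * nt - A) * Real.log 𝒳.card := by
    rw [hlogm, hAdef]
    field_simp
    ring
  have hκ : (nr : ℝ) * (1 + (⌊A⌋ : ℝ)) = ((nr * (⌊A⌋₊ + 1) : ℕ) : ℝ) := by
    push_cast
    rw [natCast_floor_eq_intCast_floor hA0.le]
    ring
  rw [hκ]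
  refine hasSNRExponent_of_bounds
    (discrete_outage_lower_bound hN hnt h𝒳 hb hD0 hA ?_ (by exact_mod_cast Nat.lt_floor_add_one A))
    fun ε hε => discrete_outage_upper_bound hN hnt h𝒳 hb hD0 hA0 hA (Nat.succ_pos _) ?_ hε
  · rw [Nat.succ_le_iff, Nat.floor_lt hA0.le]
    exact_mod_cast hAlt
  · push_cast
    linarith [Nat.floor_le hA0.le]

end

end MIMO

end

theorem theorem1 (N nt nr : ℕ) (hN : 0 < N) (hnt : 0 < nt) (hnr : 0 < nr)
    (b Dbar : ℝ) (hb : 0 < b) (hD0 : 0 < Dbar) (hD1 : Dbar < 1) :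
    MIMO.HasSNRExponent (MIMO.txOutageProb N nr (MIMO.gaussianInput nt) b Dbar)
      ((nt : ℝ) * nr * N) ∧
    ∀ (𝒳 : Finset ℂ) (m : ℝ), 2 ≤ 𝒳.card → m = Real.logb 2 𝒳.card →
      MIMO.rateDistortion Dbar / b < nt * m →
      MIMO.HasSNRExponent (MIMO.txOutageProb N nr (MIMO.discreteInput nt 𝒳) b Dbar)
        ((nr : ℝ) * (1 + (⌊(N : ℝ) * (nt - MIMO.rateDistortion Dbar / (b * m))⌋ : ℝ))) := by
  exact ⟨MIMO.hasSNRExponent_gaussianInput hN hnt hb hD0 hD1, fun _ _ h𝒳 hm hrate =>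
    MIMO.hasSNRExponent_discreteInput hN hnt hb hD0 hD1 h𝒳 hm hrate⟩
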